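/- **Setting.** Let $d\ge 0$, $n,m\ge 1$, and let $f_{ij}:\mathbb{R}^d\to\mathbb{R}$ ($i\in[n]$, $j\in[m]$) be convex and $L$-smooth, $L>0$ (differentiable with $L$-Lipschitz gradient in the Euclidean norm). Put $f_i=\frac1m\sum_{j=1}^m f_{ij}$ and $f=\frac1n\sum_{i=1}^n f_i$. Let $f$ be $\mu$-quasi strongly convex, $\mu\ge 0$: $f$ has a unique minimizer $x^*$ and $f(x^*)\ge f(x)+\langle\nabla f(x),x^*-x\rangle+\frac{\mu}{2}\|x-x^*\|^2$ for all $x\in\mathbb{R}^d$. Let $\mathcal C$ be a (possibly randomized) compression operator on $\mathbb{R}^d$ with $\mathbf{E}\|\mathcal C(x)-x\|^2\le(1-\delta)\|x\|^2$ for all $x$, where $\delta\in(0,1]$, and let $p\in(0,1)$, $\gamma>0$. **Method (EC-LSVRGstar).** Start from $x^0\in\mathbb{R}^d$, $w_1^0,\dots,w_n^0\in\mathbb{R}^d$ and $e_i^0=0$. In iteration $k=0,1,\dots$ every worker $i\in[n]$ draws $l$ uniformly from $[m]$, a coin that succeeds with probability $p$, and the randomness of $\mathcal C$; for each worker these three draws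 are independent of each other, and the draws of iteration $k$ are independent of all earlier iterations. Worker $i$ sets $$g_i^k=\nabla f_{il}(x^k)-\nabla f_{il}(w_i^k)+\nabla f_i(w_i^k)-\nabla f_i(x^*),\quad v_i^k=\mathcal C(e_i^k+\gamma g_i^k),\quad e_i^{k+1}=e_i^k+\gamma g_i^k-v_i^k,$$ and $w_i^{k+1}=x^k$ if the coin succeeds, $w_i^{k+1}=w_i^k$ otherwise. Then $x^{k+1}=x^k-\frac1n\sum_i v_i^k$. Let $g^k=\frac1n\sum_i g_i^k$, $e^k=\frac1n\sum_i e_i^k$, $\sigma_k^2=\frac{1}{nm}\sum_{i=1}^n\sum_{j=1}^m\|\nabla f_{ij}(w_i^k)-\nabla f_{ij}(x^*)\|^2$, let $\mathbf{E}_k$ be the conditional expectation given all draws before iteration $k$, and $\bar g_i^k=\mathbf{E}_k[g_i^k]$. Put $$\eta=\min\left\{\tfrac{\gamma\mu}{2},\tfrac p4\right\},\quad \omega_k=(1-\eta)^{-(k+1)},\quad W_K=\sum_{k=0}^K\omega_k,\quad \bar x^K=\frac1{W_K}\sum_{k=0}^K\omega_kx^k,$$ $$\gamma_0=\min\left\{\frac{3}{56L},\frac{\delta}{8L\sqrt{3\left(1+\delta\left(1+\frac{2}{1-p}\right)\right)}}\right\},\quad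 F_2=\frac{48L\gamma^2(2+p)}{\delta p},\quad M_2=\frac{8}{3p},$$ $$T^0=\|x^0-x^*\|^2+M_2\gamma^2\sigma_0^2,\qquad \Phi=\frac{4(T^0+\gamma F_2\sigma_0^2)}{\gamma}.$$ **Theorem.** There is an absolute constant $c>0$ such that in this setting, if $0<\gamma\le\gamma_0$, all moments below are finite and the following holds. 1. For all $k\ge0$, almost surely, $\mathbf{E}_k[g^k]=\nabla f(x^k)$ and $$\frac1n\sum_{i=1}^n\|\bar g_i^k\|^2\le 2L(f(x^k)-f(x^*)),\qquad \frac1n\sum_{i=1}^n\mathbf{E}_k\|g_i^k-\bar g_i^k\|^2\le 4L(f(x^k)-f(x^*))+2\sigma_k^2,$$ $$\mathbf{E}_k\|g^k\|^2\le 4L(f(x^k)-f(x^*))+2\sigma_k^2,\qquad \mathbf{E}_k[\sigma_{k+1}^2]\le(1-p)\sigma_k^2+2Lp(f(x^k)-f(x^*)).$$ 2. For all $K\ge0$, $$3L\sum_{k=0}^K\omega_k\mathbf{E}\|e^k\|^2\le\frac14\sum_{k=0}^K\omega_k\mathbf{E}[f(x^k)-f(x^*)]+F_2\sigma_0^2.$$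 3. If $\mu>0$, then for all $K\ge0$ $$\mathbf{E}[f(\bar x^K)-f(x^*)]\le\left(1-\min\left\{\tfrac{\gamma\mu}2,\tfrac p4\right\}\right)^K\frac{4(T^0+\gamma F_2\sigma_0^2)}{\gamma}.$$ 4. If $\mu=0$, then for all $K\ge1$ $$\mathbf{E}[f(\bar x^K)-f(x^*)]\le\frac{4(T^0+\gamma F_2\sigma_0^2)}{\gamma K}.$$ 5. Let $\mu>0$, $\kappa=L/\mu$ and $\gamma=\gamma_0$. For every $\varepsilon>0$, $\mathbf{E}[f(\bar x^K)-f(x^*)]\le\varepsilon$ for all $K\ge c\left(\frac1p+\frac{\kappa}{\delta\sqrt{1-p}}\right)\ln\frac{\Phi}{\varepsilon}$. If moreover $m\ge2$ and $p=\frac1m$, the same holds for all $K\ge c\left(m+\frac\kappa\delta\right)\ln\frac{\Phi}{\varepsilon}$. (Here $\ln 0$ is read as $0$ when $\Phi=0$.) -/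

import Mathlib

open MeasureTheory ProbabilityTheory
open scoped BigOperators ENNReal

noncomputable section

/-- The space `ℝ^d` with the Euclidean norm. -/
abbrev Vec (d : ℕ) : Type := EuclideanSpace ℝ (Fin d)

/-! ### The objective -/

/-- `f_i = (1/m) ∑_j f_{ij}`. -/
def localObj {d n m : ℕ} (f : Fin n → Fin m → Vec d → ℝ) (i : Fin n) (x : Vec d) : ℝ :=
  (m : ℝ)⁻¹ * ∑ j, f i j x

/-- `f = (1/n) ∑_i f_i`. -/
def globalObj {d n m : ℕ} (f : Fin n → Fin m → Vec d → ℝ) (x : Vec d) : ℝ :=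
  (n : ℝ)⁻¹ * ∑ i, localObj f i x

/-- `L`-smoothness: differentiable with `L`-Lipschitz gradient. -/
def IsLSmooth {d : ℕ} (L : ℝ) (h : Vec d → ℝ) : Prop :=
  Differentiable ℝ h ∧ ∀ x y, ‖gradient h x - gradient h y‖ ≤ L * ‖x - y‖

/-- `h` is `μ`-quasi strongly convex, with unique minimizer `xs`. -/
def IsQuasiStronglyConvex {d : ℕ} (μ : ℝ) (h : Vec d → ℝ) (xs : Vec d) : Prop :=
  (∀ x, h xs ≤ h x) ∧ (∀ y, (∀ x, h y ≤ h x) → y = xs) ∧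
    ∀ x, h x + inner ℝ (gradient h x) (xs - x) + μ / 2 * ‖x - xs‖ ^ 2 ≤ h xs

/-! ### Randomness -/

/-- A (possibly randomized) compression operator with contraction parameter `δ`. The randomness
is a seed with law `ν`; a deterministic operator is one that ignores its seed. -/
def IsCompressor {d : ℕ} {S : Type*} [MeasurableSpace S] (ν : Measure S) (δ : ℝ)
    (C : S → Vec d → Vec d) : Prop :=
  Measurable (Function.uncurry C) ∧
    ∀ x, Integrable (fun s => ‖C s x - x‖ ^ 2) ν ∧
      ∫ s, ‖C s x - x‖ ^ 2 ∂ν ≤ (1 - δ) * ‖x‖ ^ 2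

/-- The law of a coin that shows `true` with probability `p`. -/
def coinLaw (p : ℝ) : Measure Bool :=
  ENNReal.ofReal p • Measure.dirac true + ENNReal.ofReal (1 - p) • Measure.dirac false

/-- `ζ k ω i = (l, b, s)` are the random choices of worker `i` in iteration `k`: the index
`l ∈ [m]`, the coin `b` that decides whether the reference point is refreshed, and the seed `s` of
the compressor. Different iterations are independent, and for each worker the three choices of an
iteration are independent, `l` being uniform, `b` a `p`-coin and `s` of law `ν`. The choices of
different workers in one iteration may be independent, or coupled in any way. -/
structure IsDrawSequence {Ω S : Type*} [MeasurableSpace Ω] [MeasurableSpace S] {n m : ℕ}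
    (P : Measure Ω) (ν : Measure S) (p : ℝ)
    (ζ : ℕ → Ω → Fin n → Fin m × Bool × S) : Prop where
  measurable : ∀ k, Measurable (ζ k)
  indep : iIndepFun ζ P
  law : ∀ k i, P.map (fun ω => ζ k ω i) =
    (uniformOn (Set.univ : Set (Fin m))).prod ((coinLaw p).prod ν)

/-- The `σ`-algebra of everything that happened before iteration `k`. -/
abbrev history {Ω D : Type*} [MeasurableSpace D] (ζ : ℕ → Ω → D) (k : ℕ) : MeasurableSpace Ω :=
  ⨆ j : Fin k, MeasurableSpace.comap (ζ j) inferInstance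

/-! ### The method EC-LSVRGstar -/

/-- The iterate `x`, the errors `e_i` and the reference points `w_i`. -/
structure ECState (d n : ℕ) where
  x : Vec d
  e : Fin n → Vec d
  w : Fin n → Vec d

/-- `g_i = ∇f_{il}(x) - ∇f_{il}(w_i) + ∇f_i(w_i) - ∇f_i(x*)`. -/
def stochGrad {d n m : ℕ} (f : Fin n → Fin m → Vec d → ℝ) (xs : Vec d) (s : ECState d n)
    (i : Fin n) (l : Fin m) : Vec d :=
  gradient (f i l) s.x - gradient (f i l) (s.w i)
    + gradient (localObj f i) (s.w i) - gradient (localObj f i) xs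

/-- One iteration, given the random choices `z i = (l, b, s)` of the workers. -/
def ECState.step {d n m : ℕ} {S : Type*} (f : Fin n → Fin m → Vec d → ℝ) (xs : Vec d) (γ : ℝ)
    (C : S → Vec d → Vec d) (st : ECState d n) (z : Fin n → Fin m × Bool × S) : ECState d n :=
  let g : Fin n → Vec d := fun i => stochGrad f xs st i (z i).1
  let v : Fin n → Vec d := fun i => C (z i).2.2 (st.e i + γ • g i)
  { x := st.x - (n : ℝ)⁻¹ • ∑ i, v i
    e := fun i => st.e i + γ • g i - v i
    w := fun i => if (z i).2.1 = true then st.x else st.w i }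

/-- The trajectory of the method, started at `x0`, zero errors and reference points `w0`. -/
def ecRun {d n m : ℕ} {Ω S : Type*} (f : Fin n → Fin m → Vec d → ℝ) (xs : Vec d) (γ : ℝ)
    (C : S → Vec d → Vec d) (x0 : Vec d) (w0 : Fin n → Vec d)
    (ζ : ℕ → Ω → Fin n → Fin m × Bool × S) : ℕ → Ω → ECState d n
  | 0, _ => { x := x0, e := fun _ => 0, w := w0 }
  | k + 1, ω => (ecRun f xs γ C x0 w0 ζ k ω).step f xs γ C (ζ k ω)

/-- `(1/(nm)) ∑_i ∑_j ‖∇f_{ij}(w_i) - ∇f_{ij}(x*)‖²`. -/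
def sigmaSq {d n m : ℕ} (f : Fin n → Fin m → Vec d → ℝ) (xs : Vec d) (w : Fin n → Vec d) : ℝ :=
  ((n : ℝ) * m)⁻¹ * ∑ i, ∑ j, ‖gradient (f i j) (w i) - gradient (f i j) xs‖ ^ 2

/-! ### Weighted averages -/

/-- `w_k = (1 - η)^{-(k+1)}`. -/
def weight (η : ℝ) (k : ℕ) : ℝ := ((1 - η) ^ (k + 1))⁻¹

/-- `W_K = ∑_{k ≤ K} w_k`. -/
def weightSum (η : ℝ) (K : ℕ) : ℝ := ∑ k ∈ Finset.range (K + 1), weight η k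

/-- `x̄^K = (1/W_K) ∑_{k ≤ K} w_k x^k`. -/
def weightedAvg {d : ℕ} (η : ℝ) (x : ℕ → Vec d) (K : ℕ) : Vec d :=
  (weightSum η K)⁻¹ • ∑ k ∈ Finset.range (K + 1), weight η k • x k

/-! ### The parametric assumption on error-feedback methods -/

/-- The constants of the parametric assumption; a `t` in a name stands for a tilde. -/
structure KeyConstants where
  A : ℝ
  At : ℝ
  A' : ℝ
  B1 : ℝ
  B2 : ℝ
  Bt1 : ℝ
  Bt2 : ℝ
  B1' : ℝ
  B2' : ℝ
  C1 : ℝ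
  C2 : ℝ
  G : ℝ
  D1 : ℝ
  Dt1 : ℝ
  D1' : ℝ
  D2 : ℝ
  D3 : ℝ
  F1 : ℝ
  F2 : ℝ
  ρ1 : ℝ
  ρ2 : ℝ

/-- All constants are nonnegative, and `ρ1, ρ2 ≤ 1`. -/
def KeyConstants.Admissible (c : KeyConstants) : Prop :=
  0 ≤ c.A ∧ 0 ≤ c.At ∧ 0 ≤ c.A' ∧ 0 ≤ c.B1 ∧ 0 ≤ c.B2 ∧ 0 ≤ c.Bt1 ∧ 0 ≤ c.Bt2 ∧
  0 ≤ c.B1' ∧ 0 ≤ c.B2' ∧ 0 ≤ c.C1 ∧ 0 ≤ c.C2 ∧ 0 ≤ c.G ∧ 0 ≤ c.D1 ∧ 0 ≤ c.Dt1 ∧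
  0 ≤ c.D1' ∧ 0 ≤ c.D2 ∧ 0 ≤ c.D3 ∧ 0 ≤ c.F1 ∧ 0 ≤ c.F2 ∧
  0 ≤ c.ρ1 ∧ c.ρ1 ≤ 1 ∧ 0 ≤ c.ρ2 ∧ c.ρ2 ≤ 1

/-- The parametric assumption on the stochastic gradients `g k i` at the iterates `x k`, where
`ℱ k` is the information available before iteration `k` and `s1`, `s2` are the sequences
`σ_{1,k}²`, `σ_{2,k}²`. Conditional expectations in iteration `k` are given `ℱ k`; the moments they
involve are finite. -/
structure KeyAssumption {d n : ℕ} {Ω : Type*} [MeasurableSpace Ω] (P : Measure Ω)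
    (ℱ : ℕ → MeasurableSpace Ω) (F : Vec d → ℝ) (xs : Vec d) (x : ℕ → Ω → Vec d)
    (g : ℕ → Fin n → Ω → Vec d) (s1 s2 : ℕ → Ω → ℝ) (c : KeyConstants) : Prop where
  admissible : c.Admissible
  memLp_g : ∀ k i, MemLp (g k i) 2 P
  integrable_gap : ∀ k, Integrable (fun ω => F (x k ω) - F xs) P
  integrable_s1 : ∀ k, Integrable (s1 k) P
  integrable_s2 : ∀ k, Integrable (s2 k) P
  s1_nonneg : ∀ k ω, 0 ≤ s1 k ω
  s2_nonneg : ∀ k ω, 0 ≤ s2 k ω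
  unbiased : ∀ k, P[fun ω => (n : ℝ)⁻¹ • ∑ i, g k i ω | ℱ k]
    =ᵐ[P] fun ω => gradient F (x k ω)
  mean_bound : ∀ k, ∀ᵐ ω ∂P, (n : ℝ)⁻¹ * ∑ i, ‖(P[g k i | ℱ k]) ω‖ ^ 2 ≤
    2 * c.A * (F (x k ω) - F xs) + c.B1 * s1 k ω + c.B2 * s2 k ω + c.D1
  variance_bound : ∀ k, ∀ᵐ ω ∂P,
    (n : ℝ)⁻¹ * ∑ i, (P[fun ω' => ‖g k i ω' - (P[g k i | ℱ k]) ω'‖ ^ 2 | ℱ k]) ω ≤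
      2 * c.At * (F (x k ω) - F xs) + c.Bt1 * s1 k ω + c.Bt2 * s2 k ω + c.Dt1
  second_moment_bound : ∀ k, ∀ᵐ ω ∂P,
    (P[fun ω' => ‖(n : ℝ)⁻¹ • ∑ i, g k i ω'‖ ^ 2 | ℱ k]) ω ≤
      2 * c.A' * (F (x k ω) - F xs) + c.B1' * s1 k ω + c.B2' * s2 k ω + c.D1'
  s1_bound : ∀ k, ∀ᵐ ω ∂P, (P[s1 (k + 1) | ℱ k]) ω ≤
    (1 - c.ρ1) * s1 k ω + 2 * c.C1 * (F (x k ω) - F xs) + c.G * c.ρ1 * s2 k ω + c.D2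
  s2_bound : ∀ k, ∀ᵐ ω ∂P, (P[s2 (k + 1) | ℱ k]) ω ≤
    (1 - c.ρ2) * s2 k ω + 2 * c.C2 * (F (x k ω) - F xs)

/-- The bound on the accumulated errors `e k`, for the weights given by
`η = min {γμ/2, ρ1/4, ρ2/4}`. -/
def ErrorSumBound {d : ℕ} {Ω : Type*} [MeasurableSpace Ω] (P : Measure Ω) (F : Vec d → ℝ)
    (xs : Vec d) (x e : ℕ → Ω → Vec d) (s1 s2 : ℕ → Ω → ℝ) (L μ γ : ℝ)
    (c : KeyConstants) : Prop :=
  (∀ k, MemLp (e k) 2 P) ∧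
    ∀ K : ℕ,
      let η := min (γ * μ / 2) (min (c.ρ1 / 4) (c.ρ2 / 4))
      3 * L * ∑ k ∈ Finset.range (K + 1), weight η k * ∫ ω, ‖e k ω‖ ^ 2 ∂P ≤
        1 / 4 * ∑ k ∈ Finset.range (K + 1), weight η k * ∫ ω, (F (x k ω) - F xs) ∂P
          + c.F1 * ∫ ω, s1 0 ω ∂P + c.F2 * ∫ ω, s2 0 ω ∂P + γ * c.D3 * weightSum η K

/-! ### The constants of EC-LSVRGstar -/

/-- The largest admissible stepsize. -/
def stepBound (L δ p : ℝ) : ℝ :=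
  min (3 / (56 * L)) (δ / (8 * L * √(3 * (1 + δ * (1 + 2 / (1 - p))))))

/-- `F_2 = 48 L γ² (2 + p) / (δ p)`. -/
def constF2 (L δ p γ : ℝ) : ℝ := 48 * L * γ ^ 2 * (2 + p) / (δ * p)

/-- The constants with which EC-LSVRGstar satisfies the parametric assumption. -/
def starConstants (L δ p γ : ℝ) : KeyConstants where
  A := L
  At := 2 * L
  A' := 2 * L
  B1 := 0
  B2 := 0
  Bt1 := 0
  Bt2 := 2
  B1' := 0
  B2' := 2
  C1 := 0
  C2 := L * p
  G := 0
  D1 := 0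
  Dt1 := 0
  D1' := 0
  D2 := 0
  D3 := 0
  F1 := 0
  F2 := constF2 L δ p γ
  ρ1 := 1
  ρ2 := p

/-- `T = ‖x - x*‖² + M_2 γ² σ²` with `M_2 = 8 / (3p)`, at the iterate `x` and the reference
points `w`. -/
def lyapunov {d n m : ℕ} (f : Fin n → Fin m → Vec d → ℝ) (xs : Vec d) (p γ : ℝ) (x : Vec d)
    (w : Fin n → Vec d) : ℝ :=
  ‖x - xs‖ ^ 2 + 8 / (3 * p) * γ ^ 2 * sigmaSq f xs w

/-- `4 (T^0 + γ F_2 σ_0²) / γ`. -/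
def initConst {d n m : ℕ} (f : Fin n → Fin m → Vec d → ℝ) (xs : Vec d) (L δ p γ : ℝ)
    (x0 : Vec d) (w0 : Fin n → Vec d) : ℝ :=
  4 * (lyapunov f xs p γ x0 w0 + γ * constF2 L δ p γ * sigmaSq f xs w0) / γ

end

/-! ### Convex and smooth functions -/

section Smooth

variable {d : ℕ} {h : Vec d → ℝ} {L : ℝ}

theorem hasDerivAt_comp_line (hd : Differentiable ℝ h) (y v : Vec d) (t : ℝ) :
    HasDerivAt (fun s : ℝ => h (y + s • v)) (inner ℝ (gradient h (y + t • v)) v) t := by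
  have hl : HasDerivAt (fun s : ℝ => y + s • v) v t := by
    simpa using ((hasDerivAt_id t).smul_const v).const_add y
  have := (hd (y + t • v)).hasFDerivAt.comp_hasDerivAt t hl
  rwa [← inner_gradient_left] at this

theorem ConvexOn.add_inner_gradient_le (hc : ConvexOn ℝ Set.univ h) (hd : Differentiable ℝ h)
    (x y : Vec d) : h y + inner ℝ (gradient h y) (x - y) ≤ h x := by
  have hφ : ConvexOn ℝ Set.univ (fun s : ℝ => h (y + s • (x - y))) := by
    have := hc.comp_affineMap (AffineMap.lineMap (k := ℝ) y x)
    simpa [Function.comp_def, AffineMap.lineMap_apply, add_comm] using this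
  have h1 := hφ.le_slope_of_hasDerivAt (Set.mem_univ (0 : ℝ)) (Set.mem_univ (1 : ℝ)) one_pos
    (hasDerivAt_comp_line hd y (x - y) 0)
  simp only [zero_smul, add_zero, slope_def_field, one_smul, add_sub_cancel, sub_zero,
    div_one] at h1
  linarith

theorem IsLSmooth.le_add_inner_gradient (hs : IsLSmooth L h) (x y : Vec d) :
    h x ≤ h y + inner ℝ (gradient h y) (x - y) + L / 2 * ‖x - y‖ ^ 2 := by
  set v := x - y with hv
  let φ : ℝ → ℝ := fun t => h (y + t • v) - t * inner ℝ (gradient h y) v - L / 2 * ‖v‖ ^ 2 * t ^ 2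
  have hφ : ∀ t, HasDerivAt φ (inner ℝ (gradient h (y + t • v)) v - inner ℝ (gradient h y) v
      - L / 2 * ‖v‖ ^ 2 * (2 * t)) t := by
    intro t
    have h2 := ((hasDerivAt_id t).mul_const (inner ℝ (gradient h y) v))
    have h3 := ((hasDerivAt_id t).pow 2).const_mul (L / 2 * ‖v‖ ^ 2)
    refine (((hasDerivAt_comp_line hs.1 y v t).sub h2).sub h3).congr_deriv ?_
    simp
  have hanti : AntitoneOn φ (Set.Icc 0 1) := by
    refine antitoneOn_of_deriv_nonpos (convex_Icc 0 1)
      (fun t _ => (hφ t).continuousAt.continuousWithinAt)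
      (fun t _ => (hφ t).differentiableAt.differentiableWithinAt) fun t ht => ?_
    rw [interior_Icc] at ht
    rw [(hφ t).deriv, ← inner_sub_left]
    have h1 := real_inner_le_norm (gradient h (y + t • v) - gradient h y) v
    have h2 := hs.2 (y + t • v) y
    rw [add_sub_cancel_left, norm_smul, Real.norm_of_nonneg ht.1.le] at h2
    nlinarith [mul_le_mul_of_nonneg_right h2 (norm_nonneg v)]
  have := hanti (Set.left_mem_Icc.2 zero_le_one) (Set.right_mem_Icc.2 zero_le_one) zero_le_one
  simp only [φ, hv, one_smul, zero_smul, add_zero, add_sub_cancel] at this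
  simp only [hv]
  linarith

theorem IsLSmooth.norm_gradient_sub_sq_le (hL : 0 < L) (hc : ConvexOn ℝ Set.univ h)
    (hs : IsLSmooth L h) (x y : Vec d) :
    ‖gradient h x - gradient h y‖ ^ 2 ≤
      2 * L * (h x - h y - inner ℝ (gradient h y) (x - y)) := by
  set D := gradient h x - gradient h y with hD
  have h1 := hc.add_inner_gradient_le hs.1 (x - L⁻¹ • D) y
  have h2 := hs.le_add_inner_gradient (x - L⁻¹ • D) x
  have h3 : x - L⁻¹ • D - y = (x - y) - L⁻¹ • D := by abel
  have h4 : x - L⁻¹ • D - x = - (L⁻¹ • D) := by abel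
  rw [h3, inner_sub_right, inner_smul_right] at h1
  rw [h4, inner_neg_right, inner_smul_right, norm_neg, norm_smul, mul_pow, Real.norm_eq_abs,
    sq_abs] at h2
  have h5 : inner ℝ (gradient h x) D - inner ℝ (gradient h y) D = ‖D‖ ^ 2 := by
    rw [← inner_sub_left, ← hD, real_inner_self_eq_norm_sq]
  have h6 : L / 2 * (L⁻¹ ^ 2 * ‖D‖ ^ 2) = L⁻¹ * ‖D‖ ^ 2 / 2 := by field_simp
  have h7 : L⁻¹ * ‖D‖ ^ 2 / 2 ≤ h x - h y - inner ℝ (gradient h y) (x - y) := by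
    rw [h6] at h2
    have := congrArg (L⁻¹ * ·) h5
    simp only [mul_sub] at this
    linarith
  have h8 := mul_le_mul_of_nonneg_left h7 (by positivity : (0 : ℝ) ≤ 2 * L)
  have h9 : 2 * L * (L⁻¹ * ‖D‖ ^ 2 / 2) = ‖D‖ ^ 2 := by field_simp
  linarith

theorem IsLSmooth.continuous_gradient (hs : IsLSmooth L h) : Continuous (gradient h) := by
  have hlip : LipschitzWith L.toNNReal (gradient h) := by
    refine LipschitzWith.of_dist_le_mul fun x y => ?_
    rw [dist_eq_norm, dist_eq_norm]
    exact (hs.2 x y).trans (mul_le_mul_of_nonneg_right (Real.le_coe_toNNReal L) (norm_nonneg _))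
  exact hlip.continuous

theorem gradient_eq_zero_of_forall_le (x : Vec d) (hmin : ∀ y, h x ≤ h y) :
    gradient h x = 0 := by
  have : fderiv ℝ h x = 0 :=
    IsLocalMin.fderiv_eq_zero (Filter.Eventually.of_forall hmin)
  simp [gradient, this]

theorem gradient_const_mul_sum {ι : Type*} [Fintype ι] (c : ℝ) {F : ι → Vec d → ℝ}
    (hF : ∀ i, Differentiable ℝ (F i)) (x : Vec d) :
    gradient (fun x => c * ∑ i, F i x) x = c • ∑ i, gradient (F i) x := by
  have h1 : HasFDerivAt (fun x => c * ∑ i, F i x) (c • ∑ i, fderiv ℝ (F i) x) x :=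
    (HasFDerivAt.fun_sum fun i _ => (hF i x).hasFDerivAt).const_mul c
  simp [gradient, h1.fderiv, map_sum]

theorem IsLSmooth.const_mul_sum {ι : Type*} [Fintype ι] {F : ι → Vec d → ℝ} {c : ℝ} (hc : 0 ≤ c)
    (hcard : c * Fintype.card ι = 1) (hF : ∀ i, IsLSmooth L (F i)) :
    IsLSmooth L (fun x => c * ∑ i, F i x) := by
  refine ⟨(Differentiable.fun_sum fun i _ => (hF i).1).const_mul c, fun x y => ?_⟩
  rw [gradient_const_mul_sum c fun i => (hF i).1, gradient_const_mul_sum c fun i => (hF i).1,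
    ← smul_sub, ← Finset.sum_sub_distrib, norm_smul, Real.norm_of_nonneg hc]
  calc c * ‖∑ i, (gradient (F i) x - gradient (F i) y)‖
      ≤ c * ∑ _i : ι, L * ‖x - y‖ := by
        gcongr
        exact (norm_sum_le _ _).trans (Finset.sum_le_sum fun i _ => (hF i).2 x y)
    _ = c * Fintype.card ι * (L * ‖x - y‖) := by simp; ring
    _ = L * ‖x - y‖ := by rw [hcard, one_mul]

theorem ConvexOn.const_mul_sum {ι : Type*} [Fintype ι] {F : ι → Vec d → ℝ} {c : ℝ} (hc : 0 ≤ c)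
    (hF : ∀ i, ConvexOn ℝ Set.univ (F i)) : ConvexOn ℝ Set.univ (fun x => c * ∑ i, F i x) := by
  have : ConvexOn ℝ Set.univ (∑ i, F i) := by
    refine ⟨convex_univ, fun x _ y _ a b ha hb hab => ?_⟩
    simp only [Finset.sum_apply, Finset.smul_sum, ← Finset.sum_add_distrib]
    exact Finset.sum_le_sum fun i _ => (hF i).2 trivial trivial ha hb hab
  simpa [Pi.smul_def] using this.smul hc

end Smooth

/-! ### Finite averages -/

section Average

variable {ι E : Type*} [Fintype ι] [NormedAddCommGroup E] [InnerProductSpace ℝ E]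

theorem norm_add_sq_le_two (a b : E) : ‖a + b‖ ^ 2 ≤ 2 * ‖a‖ ^ 2 + 2 * ‖b‖ ^ 2 := by
  have := parallelogram_law_with_norm ℝ a b
  nlinarith [sq_nonneg ‖a - b‖]

/-- The mean of `‖a + g i‖²` is `‖a + ḡ‖²` plus the variance of `g`. -/
theorem average_norm_add_sq {c : ℝ} (hcard : c * Fintype.card ι = 1) (a : E) (g : ι → E) :
    c * ∑ i, ‖a + g i‖ ^ 2 =
      ‖a + c • ∑ i, g i‖ ^ 2 + c * ∑ i, ‖g i - c • ∑ j, g j‖ ^ 2 := by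
  set b := c • ∑ i, g i with hb
  have h0 : c * ∑ i, (inner ℝ (a + b) (g i - b)) = 0 := by
    rw [← inner_sum, ← inner_smul_right, Finset.sum_sub_distrib, smul_sub, ← hb]
    simp [← Nat.cast_smul_eq_nsmul ℝ, smul_smul, hcard]
  have h1 : ∀ i, ‖a + g i‖ ^ 2 = ‖a + b‖ ^ 2 + 2 * inner ℝ (a + b) (g i - b) + ‖g i - b‖ ^ 2 := by
    intro i
    rw [← norm_add_sq_real]
    congr 2; abel
  simp_rw [h1, Finset.sum_add_distrib, ← Finset.mul_sum, mul_add]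
  simp only [Finset.sum_const, Finset.card_univ, nsmul_eq_mul]
  rw [← mul_assoc c, hcard]
  linarith

theorem average_norm_sub_average_sq_le {c : ℝ} (hcard : c * Fintype.card ι = 1) (g : ι → E) :
    c * ∑ i, ‖g i - c • ∑ j, g j‖ ^ 2 ≤ c * ∑ i, ‖g i‖ ^ 2 := by
  have := average_norm_add_sq hcard 0 g
  simp only [zero_add] at this
  nlinarith [sq_nonneg ‖c • ∑ j, g j‖]

theorem norm_average_sq_le {c : ℝ} (hc : 0 ≤ c) (hcard : c * Fintype.card ι = 1) (g : ι → E) :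
    ‖c • ∑ i, g i‖ ^ 2 ≤ c * ∑ i, ‖g i‖ ^ 2 := by
  have := average_norm_add_sq hcard 0 g
  simp only [zero_add] at this
  have h2 : 0 ≤ c * ∑ i, ‖g i - c • ∑ j, g j‖ ^ 2 := by positivity
  linarith

end Average

/-! ### The objective and the stochastic gradients at a fixed state -/

section State

variable {d n m : ℕ} {f : Fin n → Fin m → Vec d → ℝ} {xs : Vec d} {L μ : ℝ}

theorem inv_natCast_mul_card_fin {k : ℕ} (hk : 0 < k) : ((k : ℝ)⁻¹) * Fintype.card (Fin k) = 1 := by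
  have : (k : ℝ) ≠ 0 := by positivity
  simp [this]

theorem isLSmooth_localObj (hm : 0 < m) (hs : ∀ i j, IsLSmooth L (f i j)) (i : Fin n) :
    IsLSmooth L (localObj f i) :=
  IsLSmooth.const_mul_sum (by positivity) (inv_natCast_mul_card_fin hm) (hs i)

theorem isLSmooth_globalObj (hn : 0 < n) (hm : 0 < m) (hs : ∀ i j, IsLSmooth L (f i j)) :
    IsLSmooth L (globalObj f) :=
  IsLSmooth.const_mul_sum (by positivity) (inv_natCast_mul_card_fin hn) (isLSmooth_localObj hm hs)

theorem convexOn_localObj (hc : ∀ i j, ConvexOn ℝ Set.univ (f i j)) (i : Fin n) :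
    ConvexOn ℝ Set.univ (localObj f i) :=
  ConvexOn.const_mul_sum (by positivity) (hc i)

theorem convexOn_globalObj (hc : ∀ i j, ConvexOn ℝ Set.univ (f i j)) :
    ConvexOn ℝ Set.univ (globalObj f) :=
  ConvexOn.const_mul_sum (by positivity) (convexOn_localObj hc)

theorem gradient_localObj (hs : ∀ i j, IsLSmooth L (f i j)) (i : Fin n) (x : Vec d) :
    gradient (localObj f i) x = (m : ℝ)⁻¹ • ∑ j, gradient (f i j) x :=
  gradient_const_mul_sum _ (fun j => (hs i j).1) x

theorem gradient_globalObj (hm : 0 < m) (hs : ∀ i j, IsLSmooth L (f i j)) (x : Vec d) :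
    gradient (globalObj f) x = (n : ℝ)⁻¹ • ∑ i, gradient (localObj f i) x :=
  gradient_const_mul_sum _ (fun i => (isLSmooth_localObj hm hs i).1) x

/-- The mean squared distance of the gradients of the summands to those at the minimizer. -/
theorem average_norm_gradient_sub_sq_le (hm : 0 < m) (hL : 0 < L)
    (hc : ∀ i j, ConvexOn ℝ Set.univ (f i j)) (hs : ∀ i j, IsLSmooth L (f i j))
    (hmin : ∀ x, globalObj f xs ≤ globalObj f x) (x : Vec d) :
    (n : ℝ)⁻¹ * ∑ i, (m : ℝ)⁻¹ * ∑ j, ‖gradient (f i j) x - gradient (f i j) xs‖ ^ 2 ≤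
      2 * L * (globalObj f x - globalObj f xs) := by
  have h0 : inner ℝ (gradient (globalObj f) xs) (x - xs) = 0 := by
    rw [gradient_eq_zero_of_forall_le xs hmin, inner_zero_left]
  rw [gradient_globalObj hm hs] at h0
  simp_rw [gradient_localObj hs] at h0
  rw [real_inner_smul_left, sum_inner] at h0
  simp_rw [real_inner_smul_left, sum_inner] at h0
  calc (n : ℝ)⁻¹ * ∑ i, (m : ℝ)⁻¹ * ∑ j, ‖gradient (f i j) x - gradient (f i j) xs‖ ^ 2
      ≤ (n : ℝ)⁻¹ * ∑ i, (m : ℝ)⁻¹ * ∑ j,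
          2 * L * (f i j x - f i j xs - inner ℝ (gradient (f i j) xs) (x - xs)) := by
        gcongr with i _ j _
        exact (hs i j).norm_gradient_sub_sq_le hL (hc i j) x xs
    _ = 2 * L * (globalObj f x - globalObj f xs - (n : ℝ)⁻¹ * ∑ i, (m : ℝ)⁻¹ * ∑ j,
          inner ℝ (gradient (f i j) xs) (x - xs)) := by
        simp only [globalObj, localObj, ← Finset.mul_sum, Finset.sum_sub_distrib]
        ring
    _ = _ := by rw [h0, sub_zero]

theorem average_norm_gradient_localObj_sub_sq_le (hm : 0 < m) (hL : 0 < L)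
    (hc : ∀ i j, ConvexOn ℝ Set.univ (f i j)) (hs : ∀ i j, IsLSmooth L (f i j))
    (hmin : ∀ x, globalObj f xs ≤ globalObj f x) (x : Vec d) :
    (n : ℝ)⁻¹ * ∑ i, ‖gradient (localObj f i) x - gradient (localObj f i) xs‖ ^ 2 ≤
      2 * L * (globalObj f x - globalObj f xs) := by
  refine le_trans ?_ (average_norm_gradient_sub_sq_le hm hL hc hs hmin x)
  gcongr with i _
  rw [gradient_localObj hs, gradient_localObj hs, ← smul_sub, ← Finset.sum_sub_distrib]
  exact norm_average_sq_le (by positivity) (inv_natCast_mul_card_fin hm) _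

theorem norm_gradient_globalObj_sq_le (hn : 0 < n) (hm : 0 < m) (hL : 0 < L)
    (hc : ∀ i j, ConvexOn ℝ Set.univ (f i j)) (hs : ∀ i j, IsLSmooth L (f i j))
    (hmin : ∀ x, globalObj f xs ≤ globalObj f x) (x : Vec d) :
    ‖gradient (globalObj f) x‖ ^ 2 ≤ 2 * L * (globalObj f x - globalObj f xs) := by
  have := (isLSmooth_globalObj hn hm hs).norm_gradient_sub_sq_le hL (convexOn_globalObj hc) x xs
  simpa [gradient_eq_zero_of_forall_le xs hmin] using this

theorem average_stochGrad (hm : 0 < m) (hs : ∀ i j, IsLSmooth L (f i j)) (s : ECState d n)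
    (i : Fin n) : (m : ℝ)⁻¹ • ∑ l, stochGrad f xs s i l =
      gradient (localObj f i) s.x - gradient (localObj f i) xs := by
  have hm' : (m : ℝ) ≠ 0 := by positivity
  simp only [stochGrad, Finset.sum_sub_distrib, Finset.sum_add_distrib, smul_sub, smul_add,
    ← gradient_localObj hs]
  simp [← Nat.cast_smul_eq_nsmul ℝ, smul_smul, hm']

/-- The second moment of `X - Y + E Y`, with `Y` measured from its mean. -/
theorem average_norm_stochGrad_sq_le (hm : 0 < m) (hs : ∀ i j, IsLSmooth L (f i j))
    (s : ECState d n) (i : Fin n) :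
    (m : ℝ)⁻¹ * ∑ l, ‖stochGrad f xs s i l‖ ^ 2 ≤
      2 * ((m : ℝ)⁻¹ * ∑ l, ‖gradient (f i l) s.x - gradient (f i l) xs‖ ^ 2) +
      2 * ((m : ℝ)⁻¹ * ∑ l, ‖gradient (f i l) (s.w i) - gradient (f i l) xs‖ ^ 2) := by
  set Y : Fin m → Vec d := fun l => gradient (f i l) (s.w i) - gradient (f i l) xs with hY
  have hYm : (m : ℝ)⁻¹ • ∑ l, Y l = gradient (localObj f i) (s.w i) - gradient (localObj f i) xs := by
    simp only [hY, Finset.sum_sub_distrib, smul_sub, ← gradient_localObj hs]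
  have hg : ∀ l, stochGrad f xs s i l =
      (gradient (f i l) s.x - gradient (f i l) xs) + -(Y l - (m : ℝ)⁻¹ • ∑ l, Y l) := by
    intro l
    rw [hYm]
    simp only [stochGrad, hY]
    abel
  have h1 := average_norm_sub_average_sq_le (inv_natCast_mul_card_fin hm) Y
  calc (m : ℝ)⁻¹ * ∑ l, ‖stochGrad f xs s i l‖ ^ 2
      ≤ (m : ℝ)⁻¹ * ∑ l, (2 * ‖gradient (f i l) s.x - gradient (f i l) xs‖ ^ 2
          + 2 * ‖Y l - (m : ℝ)⁻¹ • ∑ l, Y l‖ ^ 2) := by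
        gcongr with l _
        rw [hg l, ← norm_neg (Y l - _)]
        exact norm_add_sq_le_two _ _
    _ = 2 * ((m : ℝ)⁻¹ * ∑ l, ‖gradient (f i l) s.x - gradient (f i l) xs‖ ^ 2) +
          2 * ((m : ℝ)⁻¹ * ∑ l, ‖Y l - (m : ℝ)⁻¹ • ∑ l, Y l‖ ^ 2) := by
        rw [Finset.sum_add_distrib, ← Finset.mul_sum, ← Finset.mul_sum]; ring
    _ ≤ _ := by gcongr

theorem sigmaSq_eq (w : Fin n → Vec d) : sigmaSq f xs w =
    (n : ℝ)⁻¹ * ∑ i, (m : ℝ)⁻¹ * ∑ j, ‖gradient (f i j) (w i) - gradient (f i j) xs‖ ^ 2 := by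
  rw [sigmaSq, ← Finset.mul_sum, mul_inv, mul_assoc]

theorem sigmaSq_nonneg (w : Fin n → Vec d) : 0 ≤ sigmaSq f xs w := by
  unfold sigmaSq; positivity

theorem average_average_norm_stochGrad_sq_le (hm : 0 < m) (hL : 0 < L)
    (hc : ∀ i j, ConvexOn ℝ Set.univ (f i j)) (hs : ∀ i j, IsLSmooth L (f i j))
    (hmin : ∀ x, globalObj f xs ≤ globalObj f x) (s : ECState d n) :
    (n : ℝ)⁻¹ * ∑ i, (m : ℝ)⁻¹ * ∑ l, ‖stochGrad f xs s i l‖ ^ 2 ≤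
      4 * L * (globalObj f s.x - globalObj f xs) + 2 * sigmaSq f xs s.w := by
  calc (n : ℝ)⁻¹ * ∑ i, (m : ℝ)⁻¹ * ∑ l, ‖stochGrad f xs s i l‖ ^ 2
      ≤ (n : ℝ)⁻¹ * ∑ i,
        (2 * ((m : ℝ)⁻¹ * ∑ l, ‖gradient (f i l) s.x - gradient (f i l) xs‖ ^ 2) +
          2 * ((m : ℝ)⁻¹ * ∑ l, ‖gradient (f i l) (s.w i) - gradient (f i l) xs‖ ^ 2)) := by
        gcongr with i _
        exact average_norm_stochGrad_sq_le hm hs s i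
    _ = 2 * ((n : ℝ)⁻¹ * ∑ i, (m : ℝ)⁻¹ * ∑ l, ‖gradient (f i l) s.x - gradient (f i l) xs‖ ^ 2)
          + 2 * sigmaSq f xs s.w := by
        simp only [sigmaSq_eq, Finset.sum_add_distrib, ← Finset.mul_sum]; ring
    _ ≤ _ := by
        have := average_norm_gradient_sub_sq_le hm hL hc hs hmin s.x
        linarith

theorem average_variance_stochGrad_le (hm : 0 < m) (hL : 0 < L)
    (hc : ∀ i j, ConvexOn ℝ Set.univ (f i j)) (hs : ∀ i j, IsLSmooth L (f i j))
    (hmin : ∀ x, globalObj f xs ≤ globalObj f x) (s : ECState d n) :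
    (n : ℝ)⁻¹ * ∑ i, (m : ℝ)⁻¹ * ∑ l, ‖stochGrad f xs s i l -
        (gradient (localObj f i) s.x - gradient (localObj f i) xs)‖ ^ 2 ≤
      4 * L * (globalObj f s.x - globalObj f xs) + 2 * sigmaSq f xs s.w := by
  refine le_trans ?_ (average_average_norm_stochGrad_sq_le hm hL hc hs hmin s)
  gcongr _ * ?_
  refine Finset.sum_le_sum fun i _ => ?_
  rw [← average_stochGrad hm hs]
  exact average_norm_sub_average_sq_le (inv_natCast_mul_card_fin hm) _

theorem norm_stochGrad_le (hm : 0 < m) (hs : ∀ i j, IsLSmooth L (f i j)) (s : ECState d n)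
    (i : Fin n) (l : Fin m) :
    ‖stochGrad f xs s i l‖ ≤ L * ‖s.x - s.w i‖ + L * ‖s.w i - xs‖ := by
  rw [stochGrad, add_sub_assoc]
  exact (norm_add_le _ _).trans (add_le_add ((hs i l).2 _ _) ((isLSmooth_localObj hm hs i).2 _ _))

/-- One contraction step for the error of a worker, before the seed is drawn. -/
theorem mul_norm_add_sq_le {E : Type*} [NormedAddCommGroup E] [InnerProductSpace ℝ E] {δ : ℝ}
    (hδ0 : 0 < δ) (hδ1 : δ ≤ 1) (a b : E) :
    (1 - δ) * ‖a + b‖ ^ 2 ≤ (1 - δ / 2) * ‖a‖ ^ 2 + 2 * (1 - δ) / δ * ‖b‖ ^ 2 := by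
  have h1 : ‖a + b‖ ^ 2 ≤ (‖a‖ + ‖b‖) ^ 2 := by
    gcongr; exact norm_add_le a b
  have h2 : (1 - δ) * ‖a + b‖ ^ 2 ≤ (1 - δ) * (‖a‖ + ‖b‖) ^ 2 :=
    mul_le_mul_of_nonneg_left h1 (by linarith)
  refine h2.trans ?_
  set u := ‖a‖
  set v := ‖b‖
  have h3 : (1 - δ / 2) * u ^ 2 + 2 * (1 - δ) / δ * v ^ 2 - (1 - δ) * (u + v) ^ 2 =
      ((δ * u - 2 * (1 - δ) * v) ^ 2 + 2 * δ * (1 - δ) * v ^ 2) / (2 * δ) := by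
    field_simp; ring
  have h4 : 0 ≤ 1 - δ := by linarith
  have : 0 ≤ ((δ * u - 2 * (1 - δ) * v) ^ 2 + 2 * δ * (1 - δ) * v ^ 2) / (2 * δ) := by positivity
  linarith

theorem le_or_subsingleton (hn : 0 < n) (hm : 0 < m) (hs : ∀ i j, IsLSmooth L (f i j))
    (hq : IsQuasiStronglyConvex μ (globalObj f) xs) : μ ≤ L ∨ Subsingleton (Vec d) := by
  rcases subsingleton_or_nontrivial (Vec d) with h | h
  · exact Or.inr h
  · left
    obtain ⟨x, hx⟩ := exists_ne xs
    have h1 := hq.2.2 x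
    have h2 := (isLSmooth_globalObj hn hm hs).le_add_inner_gradient xs x
    rw [norm_sub_rev xs x] at h2
    have h3 : 0 < ‖x - xs‖ ^ 2 := by
      have := norm_pos_iff.2 (sub_ne_zero.2 hx)
      positivity
    by_contra hlt
    nlinarith

end State

/-! ### Conditioning on the past -/

section FiniteMixture

variable {Ω ι E : Type*} [NormedAddCommGroup E] [NormedSpace ℝ E]

theorem eq_sum_indicator_smul [Fintype ι] (Z : Ω → ι) (h : ι → Ω → E) :
    (fun ω => h (Z ω) ω) = ∑ z, (Z ⁻¹' {z}).indicator (fun _ => (1 : ℝ)) • h z := by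
  classical
  ext ω
  rw [Finset.sum_apply, Finset.sum_eq_single (Z ω)]
  · simp
  · intro b _ hb
    simp [Set.indicator, hb.symm]
  · simp

variable [MeasurableSpace ι] [MeasurableSingletonClass ι] {mΩ : MeasurableSpace Ω} {P : Measure Ω}

theorem integrable_indicator_one_smul {Z : Ω → ι} (hZ : Measurable Z) {h : Ω → E}
    (hi : Integrable h P) (z : ι) :
    Integrable ((Z ⁻¹' {z}).indicator (fun _ => (1 : ℝ)) • h) P := by
  have : (Z ⁻¹' {z}).indicator (fun _ => (1 : ℝ)) • h = (Z ⁻¹' {z}).indicator h := by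
    ext ω; by_cases hω : ω ∈ Z ⁻¹' {z} <;> simp_all [Set.indicator]
  rw [this]
  exact hi.indicator (hZ (measurableSet_singleton z))

theorem integrable_comp_finite [Fintype ι] {Z : Ω → ι} (hZ : Measurable Z) {h : ι → Ω → E}
    (hi : ∀ z, Integrable (h z) P) : Integrable (fun ω => h (Z ω) ω) P := by
  rw [eq_sum_indicator_smul Z h]
  exact integrable_finsetSum' _ fun z _ => integrable_indicator_one_smul hZ (hi z) z

/-- If `Z` takes finitely many values and is independent of `𝒢`, and each `h z` is
`𝒢`-measurable, then conditioning `h Z` on `𝒢` averages over `Z`. -/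
theorem condExp_comp_of_indep [Fintype ι] [CompleteSpace E] [IsProbabilityMeasure P]
    {Z : Ω → ι} (hZ : Measurable Z) {𝒢 : MeasurableSpace Ω} (h𝒢 : 𝒢 ≤ mΩ)
    (hind : Indep (MeasurableSpace.comap Z inferInstance) 𝒢 P) {h : ι → Ω → E}
    (hm : ∀ z, StronglyMeasurable[𝒢] (h z)) (hi : ∀ z, Integrable (h z) P) :
    P[fun ω => h (Z ω) ω | 𝒢] =ᵐ[P] fun ω => ∑ z, P.real (Z ⁻¹' {z}) • h z ω := by
  rw [eq_sum_indicator_smul Z h]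
  have h1 := condExp_finsetSum (μ := P) (s := Finset.univ)
    (f := fun z => (Z ⁻¹' {z}).indicator (fun _ => (1 : ℝ)) • h z)
    (fun z _ => integrable_indicator_one_smul hZ (hi z) z) 𝒢
  have h2 : ∀ z, P[(Z ⁻¹' {z}).indicator (fun _ => (1 : ℝ)) • h z | 𝒢] =ᵐ[P]
      fun ω => P.real (Z ⁻¹' {z}) • h z ω := by
    intro z
    have hmeas : MeasurableSet[mΩ] (Z ⁻¹' {z}) := hZ (measurableSet_singleton z)
    have hint : Integrable ((Z ⁻¹' {z}).indicator (fun _ => (1 : ℝ))) P :=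
      (integrable_const 1).indicator hmeas
    have h3 := condExp_smul_of_aestronglyMeasurable_right hint
      (integrable_indicator_one_smul hZ (hi z) z) (hm z).aestronglyMeasurable
    have h4 := condExp_indep_eq (μ := P) hZ.comap_le h𝒢
      (f := (Z ⁻¹' {z}).indicator (fun _ => (1 : ℝ)))
      (stronglyMeasurable_const.indicator ⟨{z}, measurableSet_singleton z, rfl⟩) hind
    rw [integral_indicator_const (1 : ℝ) hmeas, smul_eq_mul, mul_one] at h4
    filter_upwards [h3, h4] with ω h3 h4
    rw [h3, Pi.smul_apply', h4]
  have h5 : ∀ᵐ ω ∂P, ∀ z, (P[(Z ⁻¹' {z}).indicator (fun _ => (1 : ℝ)) • h z | 𝒢]) ω =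
      P.real (Z ⁻¹' {z}) • h z ω := ae_all_iff.2 h2
  filter_upwards [h1, h5] with ω h1 h5
  rw [h1, Finset.sum_apply]
  exact Finset.sum_congr rfl fun z _ => h5 z

end FiniteMixture

section History

variable {Ω D : Type*} {mΩ : MeasurableSpace Ω} [MeasurableSpace D] {P : Measure Ω}
  {ζ : ℕ → Ω → D}

theorem history_le (hζ : ∀ k, Measurable (ζ k)) (k : ℕ) : history ζ k ≤ mΩ :=
  iSup_le fun j => (hζ j).comap_le

theorem history_le_succ (ζ : ℕ → Ω → D) (k : ℕ) : history ζ k ≤ history ζ (k + 1) :=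
  iSup_le fun j => le_iSup (fun j : Fin (k + 1) => MeasurableSpace.comap (ζ j) inferInstance)
    j.castSucc

theorem measurable_history_succ (ζ : ℕ → Ω → D) (k : ℕ) : Measurable[history ζ (k + 1)] (ζ k) := by
  have h := le_iSup (fun j : Fin (k + 1) => MeasurableSpace.comap (ζ j) inferInstance) (Fin.last k)
  exact (comap_measurable (ζ k)).mono h le_rfl

theorem indep_comap_history (hζ : ∀ k, Measurable (ζ k)) (hi : iIndepFun ζ P) (k : ℕ) :
    Indep (MeasurableSpace.comap (ζ k) inferInstance) (history ζ k) P := by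
  have h := indep_iSup_of_disjoint (m := fun j => MeasurableSpace.comap (ζ j) inferInstance)
    (fun j => (hζ j).comap_le) hi.iIndep (S := {k}) (T := Set.Iio k) (by simp)
  refine indep_of_indep_of_le_left (indep_of_indep_of_le_right h ?_) (by simp)
  exact iSup_le fun j => le_iSup₂_of_le (j : ℕ) j.2 le_rfl

end History

section Draws

variable {Ω S : Type*} {mΩ : MeasurableSpace Ω} [MeasurableSpace S] {n m : ℕ} {P : Measure Ω}
  {ν : Measure S} {p : ℝ}
  {ζ : ℕ → Ω → Fin n → Fin m × Bool × S}

theorem isProbabilityMeasure_coinLaw (hp0 : 0 ≤ p) (hp1 : p ≤ 1) :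
    IsProbabilityMeasure (coinLaw p) := by
  constructor
  simp [coinLaw, ← ENNReal.ofReal_add hp0 (sub_nonneg.2 hp1)]

theorem IsDrawSequence.measurable_apply (hζ : IsDrawSequence P ν p ζ) (k : ℕ) (i : Fin n) :
    Measurable fun ω => ζ k ω i :=
  (measurable_pi_apply i).comp (hζ.measurable k)

theorem IsDrawSequence.indep_comp (hζ : IsDrawSequence P ν p ζ) (k : ℕ) (i : Fin n)
    {ι : Type*} [MeasurableSpace ι] {φ : Fin m × Bool × S → ι} (hφ : Measurable φ) :
    Indep (MeasurableSpace.comap (fun ω => φ (ζ k ω i)) inferInstance) (history ζ k) P := by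
  refine indep_of_indep_of_le_left (indep_comap_history hζ.measurable hζ.indep k) ?_
  exact ((hφ.comp (measurable_pi_apply i)).comp (comap_measurable (ζ k))).comap_le

variable [IsProbabilityMeasure ν]

theorem IsDrawSequence.real_index (hζ : IsDrawSequence P ν p ζ) (hp0 : 0 ≤ p)
    (hp1 : p ≤ 1) (k : ℕ) (i : Fin n) (l : Fin m) :
    P.real ((fun ω => (ζ k ω i).1) ⁻¹' {l}) = (m : ℝ)⁻¹ := by
  have := isProbabilityMeasure_coinLaw hp0 hp1
  have h1 : (fun ω => (ζ k ω i).1) ⁻¹' {l} =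
      (fun ω => ζ k ω i) ⁻¹' ({l} ×ˢ Set.univ) := by ext; simp
  rw [measureReal_def, h1, ← Measure.map_apply (hζ.measurable_apply k i)
    ((measurableSet_singleton l).prod MeasurableSet.univ), hζ.law, Measure.prod_prod,
    uniformOn_univ]
  simp

theorem IsDrawSequence.real_coin (hζ : IsDrawSequence P ν p ζ) (hm : 0 < m) (hp0 : 0 ≤ p)
    (hp1 : p ≤ 1) (k : ℕ) (i : Fin n) (b : Bool) :
    P.real ((fun ω => (ζ k ω i).2.1) ⁻¹' {b}) = if b = true then p else 1 - p := by
  have := isProbabilityMeasure_coinLaw hp0 hp1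
  have : Nonempty (Fin m) := ⟨⟨0, hm⟩⟩
  have h1 : (fun ω => (ζ k ω i).2.1) ⁻¹' {b} =
      (fun ω => ζ k ω i) ⁻¹' (Set.univ ×ˢ ({b} ×ˢ Set.univ)) := by ext; simp
  rw [measureReal_def, h1, ← Measure.map_apply (hζ.measurable_apply k i)
    (MeasurableSet.univ.prod ((measurableSet_singleton b).prod MeasurableSet.univ)), hζ.law,
    Measure.prod_prod, Measure.prod_prod]
  cases b <;> simp [coinLaw, hp0, hp1]

variable {E : Type*} [NormedAddCommGroup E] [NormedSpace ℝ E] [CompleteSpace E]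
  [IsProbabilityMeasure P]

theorem IsDrawSequence.condExp_index (hζ : IsDrawSequence P ν p ζ) (hp0 : 0 ≤ p)
    (hp1 : p ≤ 1) (k : ℕ) (i : Fin n) {h : Fin m → Ω → E}
    (hh : ∀ l, StronglyMeasurable[history ζ k] (h l)) (hi : ∀ l, Integrable (h l) P) :
    P[fun ω => h (ζ k ω i).1 ω | history ζ k] =ᵐ[P] fun ω => (m : ℝ)⁻¹ • ∑ l, h l ω := by
  have h1 := condExp_comp_of_indep
    (measurable_fst.comp (hζ.measurable_apply k i)) (history_le hζ.measurable k)
    (hζ.indep_comp k i measurable_fst) hh hi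
  refine h1.trans (Filter.Eventually.of_forall fun ω => ?_)
  simp only [Function.comp_def, hζ.real_index hp0 hp1, Finset.smul_sum]

theorem IsDrawSequence.integral_index (hζ : IsDrawSequence P ν p ζ) (hp0 : 0 ≤ p)
    (hp1 : p ≤ 1) (k : ℕ) (i : Fin n) {h : Fin m → Ω → E}
    (hh : ∀ l, StronglyMeasurable[history ζ k] (h l)) (hi : ∀ l, Integrable (h l) P) :
    ∫ ω, h (ζ k ω i).1 ω ∂P = ∫ ω, (m : ℝ)⁻¹ • ∑ l, h l ω ∂P := by
  rw [← integral_condExp (history_le hζ.measurable k)]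
  exact integral_congr_ae (hζ.condExp_index hp0 hp1 k i hh hi)

theorem IsDrawSequence.condExp_coin (hζ : IsDrawSequence P ν p ζ) (hm : 0 < m) (hp0 : 0 ≤ p)
    (hp1 : p ≤ 1) (k : ℕ) (i : Fin n) {a b : Ω → E}
    (ha : StronglyMeasurable[history ζ k] a) (hb : StronglyMeasurable[history ζ k] b)
    (hai : Integrable a P) (hbi : Integrable b P) :
    P[fun ω => if (ζ k ω i).2.1 = true then a ω else b ω | history ζ k] =ᵐ[P]
      fun ω => p • a ω + (1 - p) • b ω := by
  have hm2 : Measurable (fun z : Fin m × Bool × S => z.2.1) := by fun_prop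
  have h1 := condExp_comp_of_indep
    (hm2.comp (hζ.measurable_apply k i)) (history_le hζ.measurable k) (hζ.indep_comp k i hm2)
    (h := fun c ω => if c = true then a ω else b ω)
    (by rintro (_ | _) <;> simpa) (by rintro (_ | _) <;> simpa)
  refine h1.trans (Filter.Eventually.of_forall fun ω => ?_)
  simp only [Function.comp_def, hζ.real_coin hm hp0 hp1]
  simp

end Draws

section Compression

variable {Ω S : Type*} {mΩ : MeasurableSpace Ω} [MeasurableSpace S] {d n m : ℕ} {P : Measure Ω}
  [IsProbabilityMeasure P] {ν : Measure S} {p δ : ℝ}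
  {ζ : ℕ → Ω → Fin n → Fin m × Bool × S} {C : S → Vec d → Vec d}

theorem IsCompressor.lintegral_le (hC : IsCompressor ν δ C) (x : Vec d) :
    ∫⁻ s, ENNReal.ofReal (‖x - C s x‖ ^ 2) ∂ν ≤ ENNReal.ofReal ((1 - δ) * ‖x‖ ^ 2) := by
  simp_rw [norm_sub_rev x]
  rw [← ofReal_integral_eq_lintegral_ofReal (hC.2 x).1
    (Filter.Eventually.of_forall fun s => by positivity)]
  exact ENNReal.ofReal_le_ofReal (hC.2 x).2

variable [IsProbabilityMeasure ν]

theorem IsDrawSequence.lintegral_compress_le (hζ : IsDrawSequence P ν p ζ)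
    (hC : IsCompressor ν δ C) (k : ℕ) (i : Fin n)
    {Y : Fin m → Ω → Vec d} (hY : ∀ l, Measurable[history ζ k] (Y l)) :
    ∫⁻ ω, ENNReal.ofReal (‖Y (ζ k ω i).1 ω - C (ζ k ω i).2.2 (Y (ζ k ω i).1 ω)‖ ^ 2) ∂P ≤
      ∫⁻ ω, ENNReal.ofReal ((1 - δ) * ‖Y (ζ k ω i).1 ω‖ ^ 2) ∂P := by
  have : SFinite (coinLaw p) := by unfold coinLaw; infer_instance
  let H : Ω → Fin m → Vec d := fun ω l => Y l ω
  have hH : Measurable[history ζ k] H := @measurable_pi_lambda _ _ _ (history ζ k) _ _ hY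
  have hle := history_le hζ.measurable k
  have hind : IndepFun H (fun ω => ζ k ω i) P := by
    rw [IndepFun_iff_Indep]
    exact (indep_of_indep_of_le_right (hζ.indep_comp k i measurable_id) hH.comap_le).symm
  have hlaw := (indepFun_iff_map_prod_eq_prod_map_map (hH.mono hle le_rfl).aemeasurable
    (hζ.measurable_apply k i).aemeasurable).1 hind
  rw [hζ.law] at hlaw
  have hpair : Measurable fun ω => (H ω, ζ k ω i) :=
    (hH.mono hle le_rfl).prodMk (hζ.measurable_apply k i)
  have hev : Measurable fun q : (Fin m → Vec d) × (Fin m × Bool × S) => q.1 q.2.1 := by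
    have : Measurable fun q : (Fin m → Vec d) × Fin m => q.1 q.2 :=
      measurable_from_prod_countable_left fun l => measurable_pi_apply l
    exact this.comp (measurable_fst.prodMk (measurable_fst.comp measurable_snd))
  let A : (Fin m → Vec d) × (Fin m × Bool × S) → ℝ≥0∞ := fun q =>
    ENNReal.ofReal (‖q.1 q.2.1 - C q.2.2.2 (q.1 q.2.1)‖ ^ 2)
  let B : (Fin m → Vec d) × (Fin m × Bool × S) → ℝ≥0∞ := fun q =>
    ENNReal.ofReal ((1 - δ) * ‖q.1 q.2.1‖ ^ 2)
  have hCm : Measurable fun q : (Fin m → Vec d) × (Fin m × Bool × S) =>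
      C q.2.2.2 (q.1 q.2.1) :=
    hC.1.comp ((measurable_snd.comp (measurable_snd.comp measurable_snd)).prodMk hev)
  have hA : Measurable A := ((hev.sub hCm).norm.pow_const 2).ennreal_ofReal
  have hB : Measurable B := ((hev.norm.pow_const 2).const_mul _).ennreal_ofReal
  change ∫⁻ ω, A (H ω, ζ k ω i) ∂P ≤ ∫⁻ ω, B (H ω, ζ k ω i) ∂P
  rw [← lintegral_map hA hpair, ← lintegral_map hB hpair, hlaw,
    lintegral_prod _ hA.aemeasurable, lintegral_prod _ hB.aemeasurable]
  refine lintegral_mono fun y => ?_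
  have hAy : Measurable fun z => A (y, z) := hA.comp measurable_prodMk_left
  have hBy : Measurable fun z => B (y, z) := hB.comp measurable_prodMk_left
  rw [lintegral_prod _ hAy.aemeasurable, lintegral_prod _ hBy.aemeasurable]
  refine lintegral_mono fun l => ?_
  have hAl : Measurable fun z => A (y, l, z) := hAy.comp measurable_prodMk_left
  have hBl : Measurable fun z => B (y, l, z) := hBy.comp measurable_prodMk_left
  rw [lintegral_prod _ hAl.aemeasurable, lintegral_prod _ hBl.aemeasurable]
  refine lintegral_mono fun b => ?_
  simpa [A, B] using hC.lintegral_le (y l)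

theorem IsDrawSequence.memLp_compress (hζ : IsDrawSequence P ν p ζ)
    (hδ : δ ≤ 1) (hC : IsCompressor ν δ C) (k : ℕ) (i : Fin n)
    {Y : Fin m → Ω → Vec d} (hY : ∀ l, Measurable[history ζ k] (Y l))
    (hY2 : ∀ l, MemLp (Y l) 2 P)
    (hmeas : Measurable fun ω => Y (ζ k ω i).1 ω - C (ζ k ω i).2.2 (Y (ζ k ω i).1 ω)) :
    MemLp (fun ω => Y (ζ k ω i).1 ω - C (ζ k ω i).2.2 (Y (ζ k ω i).1 ω)) 2 P ∧
    ∫ ω, ‖Y (ζ k ω i).1 ω - C (ζ k ω i).2.2 (Y (ζ k ω i).1 ω)‖ ^ 2 ∂P ≤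
      (1 - δ) * ∫ ω, ‖Y (ζ k ω i).1 ω‖ ^ 2 ∂P := by
  have hint : Integrable (fun ω => (1 - δ) * ‖Y (ζ k ω i).1 ω‖ ^ 2) P :=
    (integrable_comp_finite (measurable_fst.comp (hζ.measurable_apply k i))
      (h := fun l ω => ‖Y l ω‖ ^ 2) fun l => (hY2 l).integrable_norm_pow two_ne_zero).const_mul _
  have hle := hζ.lintegral_compress_le hC k i hY
  rw [← ofReal_integral_eq_lintegral_ofReal hint (Filter.Eventually.of_forall fun ω =>
    mul_nonneg (sub_nonneg.2 hδ) (by positivity))] at hle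
  have hI : Integrable
      (fun ω => ‖Y (ζ k ω i).1 ω - C (ζ k ω i).2.2 (Y (ζ k ω i).1 ω)‖ ^ 2) P := by
    refine ⟨(hmeas.norm.pow_const 2).aestronglyMeasurable, ?_⟩
    rw [hasFiniteIntegral_iff_ofReal (Filter.Eventually.of_forall fun ω => by positivity)]
    exact hle.trans_lt ENNReal.ofReal_lt_top
  refine ⟨(memLp_two_iff_integrable_sq_norm hmeas.aestronglyMeasurable).2 hI, ?_⟩
  rw [← ofReal_integral_eq_lintegral_ofReal hI
    (Filter.Eventually.of_forall fun ω => by positivity)] at hle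
  rw [← integral_const_mul]
  refine (ENNReal.ofReal_le_ofReal_iff ?_).1 hle
  exact integral_nonneg fun ω => mul_nonneg (sub_nonneg.2 hδ) (by positivity)

end Compression

/-! ### Measurability and moments of the trajectory -/

/-- The standing assumptions on the problem, the compressor and the random choices. -/
structure IsECInstance {d n m : ℕ} {Ω S : Type*} [MeasurableSpace Ω] [MeasurableSpace S]
    (f : Fin n → Fin m → Vec d → ℝ) (xs : Vec d) (L μ : ℝ) (ν : Measure S) (δ : ℝ)
    (C : S → Vec d → Vec d) (P : Measure Ω) (p : ℝ)
    (ζ : ℕ → Ω → Fin n → Fin m × Bool × S) : Prop where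
  n_pos : 0 < n
  m_pos : 0 < m
  L_pos : 0 < L
  μ_nonneg : 0 ≤ μ
  convex : ∀ i j, ConvexOn ℝ Set.univ (f i j)
  smooth : ∀ i j, IsLSmooth L (f i j)
  qsc : IsQuasiStronglyConvex μ (globalObj f) xs
  δ_pos : 0 < δ
  δ_le : δ ≤ 1
  compressor : IsCompressor ν δ C
  p_pos : 0 < p
  p_lt : p < 1
  draws : IsDrawSequence P ν p ζ

theorem measurable_comp_countable {Ω ι E : Type*} [MeasurableSpace Ω] [MeasurableSpace ι]
    [Countable ι] [MeasurableSingletonClass ι] [MeasurableSpace E] {Z : Ω → ι} (hZ : Measurable Z)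
    {h : ι → Ω → E} (hh : ∀ z, Measurable (h z)) : Measurable fun ω => h (Z ω) ω :=
  (measurable_from_prod_countable_right (f := fun q : ι × Ω => h q.1 q.2) hh).comp
    (hZ.prodMk measurable_id)

theorem memLp_comp_finite {d : ℕ} {Ω ι : Type*} {mΩ : MeasurableSpace Ω} {P : Measure Ω}
    [Fintype ι] [MeasurableSpace ι] [MeasurableSingletonClass ι]
    {Z : Ω → ι} (hZ : Measurable Z) {h : ι → Ω → Vec d} (hh : ∀ z, Measurable (h z))
    (hi : ∀ z, MemLp (h z) 2 P) : MemLp (fun ω => h (Z ω) ω) 2 P := by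
  rw [memLp_two_iff_integrable_sq_norm (measurable_comp_countable hZ hh).aestronglyMeasurable]
  exact integrable_comp_finite hZ (h := fun z ω => ‖h z ω‖ ^ 2)
    fun z => (hi z).integrable_norm_pow two_ne_zero

theorem condExp_smul_sum {Ω ι E : Type*} [Fintype ι] [NormedAddCommGroup E] [NormedSpace ℝ E]
    [CompleteSpace E] {mΩ : MeasurableSpace Ω} {P : Measure Ω} {𝒢 : MeasurableSpace Ω}
    {h a : ι → Ω → E} (c : ℝ) (hi : ∀ i, Integrable (h i) P) (ha : ∀ i, P[h i | 𝒢] =ᵐ[P] a i) :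
    P[fun ω => c • ∑ i, h i ω | 𝒢] =ᵐ[P] fun ω => c • ∑ i, a i ω := by
  have h1 := condExp_smul (μ := P) c (fun ω => ∑ i, h i ω) 𝒢
  have h2 := condExp_finsetSum (μ := P) (s := Finset.univ) (f := h) (fun i _ => hi i) 𝒢
  have h3 : (∑ i, h i) = fun ω => ∑ i, h i ω := by ext ω; simp
  rw [h3] at h2
  have h4 : ∀ᵐ ω ∂P, ∀ i, (P[h i | 𝒢]) ω = a i ω := ae_all_iff.2 ha
  filter_upwards [h1, h2, h4] with ω h1 h2 h4
  refine h1.trans ?_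
  rw [Pi.smul_apply, h2, Finset.sum_apply]
  simp only [h4]

section StepMeasurable

variable {d n m : ℕ} {Ω S : Type*} [MeasurableSpace Ω] [MeasurableSpace S]
  {f : Fin n → Fin m → Vec d → ℝ} {xs : Vec d} {L γ δ : ℝ} {ν : Measure S}
  {C : S → Vec d → Vec d} {st : Ω → ECState d n}

theorem measurable_stochGrad (hm : 0 < m) (hs : ∀ i j, IsLSmooth L (f i j))
    (hx : Measurable fun ω => (st ω).x) (hw : ∀ i, Measurable fun ω => (st ω).w i)
    (i : Fin n) (l : Fin m) : Measurable fun ω => stochGrad f xs (st ω) i l := by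
  have h1 := (hs i l).continuous_gradient.measurable
  have h2 := (isLSmooth_localObj hm hs i).continuous_gradient.measurable
  exact (((h1.comp hx).sub (h1.comp (hw i))).add (h2.comp (hw i))).sub measurable_const

theorem measurable_add_smul_stochGrad (hm : 0 < m) (hs : ∀ i j, IsLSmooth L (f i j))
    (hx : Measurable fun ω => (st ω).x) (he : ∀ i, Measurable fun ω => (st ω).e i)
    (hw : ∀ i, Measurable fun ω => (st ω).w i) (i : Fin n) (c : ℝ) (l : Fin m) :
    Measurable fun ω => (st ω).e i + c • stochGrad f xs (st ω) i l :=
  (he i).add ((measurable_stochGrad hm hs hx hw i l).const_smul c)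

theorem measurable_step (hm : 0 < m) (hs : ∀ i j, IsLSmooth L (f i j)) (hC : IsCompressor ν δ C)
    (hx : Measurable fun ω => (st ω).x) (he : ∀ i, Measurable fun ω => (st ω).e i)
    (hw : ∀ i, Measurable fun ω => (st ω).w i) {z : Ω → Fin n → Fin m × Bool × S}
    (hz : Measurable z) :
    (Measurable fun ω => ((st ω).step f xs γ C (z ω)).x) ∧
    (∀ i, Measurable fun ω => ((st ω).step f xs γ C (z ω)).e i) ∧
    (∀ i, Measurable fun ω => ((st ω).step f xs γ C (z ω)).w i) := by
  have hzi : ∀ i, Measurable fun ω => z ω i := fun i => (measurable_pi_apply i).comp hz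
  have hy : ∀ i, Measurable fun ω => (st ω).e i + γ • stochGrad f xs (st ω) i (z ω i).1 := by
    intro i
    have : Measurable fun ω => stochGrad f xs (st ω) i (z ω i).1 :=
      measurable_comp_countable (measurable_fst.comp (hzi i))
        (h := fun l ω => stochGrad f xs (st ω) i l) (measurable_stochGrad hm hs hx hw i)
    exact (he i).add (this.const_smul γ)
  have hv : ∀ i, Measurable fun ω =>
      C (z ω i).2.2 ((st ω).e i + γ • stochGrad f xs (st ω) i (z ω i).1) := fun i =>
    hC.1.comp ((measurable_snd.comp (measurable_snd.comp (hzi i))).prodMk (hy i))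
  refine ⟨?_, fun i => (hy i).sub (hv i), fun i => ?_⟩
  · have hsum : Measurable fun ω => (n : ℝ)⁻¹ • ∑ i,
        C (z ω i).2.2 ((st ω).e i + γ • stochGrad f xs (st ω) i (z ω i).1) :=
      (Finset.measurable_fun_sum _ fun i _ => hv i).const_smul ((n : ℝ)⁻¹)
    exact hx.sub hsum
  · exact Measurable.ite ((measurable_fst.comp (measurable_snd.comp (hzi i)))
      (measurableSet_singleton true)) hx (hw i)

end StepMeasurable

section Trajectory

variable {d n m : ℕ} {Ω S : Type*} {mΩ : MeasurableSpace Ω} [MeasurableSpace S]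
  {f : Fin n → Fin m → Vec d → ℝ} {xs : Vec d} {L μ : ℝ} {ν : Measure S} {δ : ℝ}
  {C : S → Vec d → Vec d} {P : Measure Ω} {p : ℝ} {ζ : ℕ → Ω → Fin n → Fin m × Bool × S}

namespace IsECInstance

theorem measurable_ecRun (H : IsECInstance f xs L μ ν δ C P p ζ) (γ : ℝ) (x0 : Vec d)
    (w0 : Fin n → Vec d) (k : ℕ) :
    (Measurable[history ζ k] fun ω => (ecRun f xs γ C x0 w0 ζ k ω).x) ∧
    (∀ i, Measurable[history ζ k] fun ω => (ecRun f xs γ C x0 w0 ζ k ω).e i) ∧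
    (∀ i, Measurable[history ζ k] fun ω => (ecRun f xs γ C x0 w0 ζ k ω).w i) := by
  induction k with
  | zero => exact ⟨measurable_const, fun _ => measurable_const, fun _ => measurable_const⟩
  | succ k ih =>
    obtain ⟨hx, he, hw⟩ := ih
    have hle := history_le_succ ζ k
    exact @measurable_step d n m Ω S (history ζ (k + 1)) _ f xs L γ δ ν C
      (ecRun f xs γ C x0 w0 ζ k) H.m_pos H.smooth H.compressor (hx.mono hle le_rfl)
      (fun i => (he i).mono hle le_rfl) (fun i => (hw i).mono hle le_rfl) (ζ k)
      (measurable_history_succ ζ k)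

theorem measurable_add_smul_stochGrad_ecRun (H : IsECInstance f xs L μ ν δ C P p ζ) (γ : ℝ)
    (x0 : Vec d) (w0 : Fin n → Vec d) (k : ℕ) (i : Fin n) (c : ℝ) (l : Fin m) :
    Measurable[history ζ k] fun ω => (ecRun f xs γ C x0 w0 ζ k ω).e i +
      c • stochGrad f xs (ecRun f xs γ C x0 w0 ζ k ω) i l := by
  obtain ⟨hx, he, hw⟩ := H.measurable_ecRun γ x0 w0 k
  exact @measurable_add_smul_stochGrad d n m Ω (history ζ k) f xs L (ecRun f xs γ C x0 w0 ζ k)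
    H.m_pos H.smooth hx he hw i c l

theorem measurable_stochGrad_ecRun (H : IsECInstance f xs L μ ν δ C P p ζ) (γ : ℝ)
    (x0 : Vec d) (w0 : Fin n → Vec d) (k : ℕ) (i : Fin n) (l : Fin m) :
    Measurable[history ζ k] fun ω => stochGrad f xs (ecRun f xs γ C x0 w0 ζ k ω) i l := by
  obtain ⟨hx, he, hw⟩ := H.measurable_ecRun γ x0 w0 k
  exact @measurable_stochGrad d n m Ω (history ζ k) f xs L (ecRun f xs γ C x0 w0 ζ k)
    H.m_pos H.smooth hx hw i l

variable [IsProbabilityMeasure P]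

theorem memLp_stochGrad (H : IsECInstance f xs L μ ν δ C P p ζ) {st : Ω → ECState d n}
    (hx : MemLp (fun ω => (st ω).x) 2 P) (hw : ∀ i, MemLp (fun ω => (st ω).w i) 2 P)
    (hxm : Measurable fun ω => (st ω).x) (hwm : ∀ i, Measurable fun ω => (st ω).w i)
    (i : Fin n) (l : Fin m) : MemLp (fun ω => stochGrad f xs (st ω) i l) 2 P := by
  have hg : MemLp (fun ω => L * ‖(st ω).x - (st ω).w i‖ + L * ‖(st ω).w i - xs‖) 2 P :=
    ((hx.sub (hw i)).norm.const_mul L).add (((hw i).sub (memLp_const xs)).norm.const_mul L)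
  exact hg.mono' (measurable_stochGrad H.m_pos H.smooth hxm hwm i l).aestronglyMeasurable
    (Filter.Eventually.of_forall fun ω => norm_stochGrad_le H.m_pos H.smooth (st ω) i l)

variable [IsProbabilityMeasure ν]

/-- All iterates, errors and reference points have finite second moments. -/
theorem memLp_ecRun (H : IsECInstance f xs L μ ν δ C P p ζ) (γ : ℝ) (x0 : Vec d)
    (w0 : Fin n → Vec d) (k : ℕ) :
    MemLp (fun ω => (ecRun f xs γ C x0 w0 ζ k ω).x) 2 P ∧
    (∀ i, MemLp (fun ω => (ecRun f xs γ C x0 w0 ζ k ω).e i) 2 P) ∧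
    (∀ i, MemLp (fun ω => (ecRun f xs γ C x0 w0 ζ k ω).w i) 2 P) := by
  induction k with
  | zero => exact ⟨memLp_const _, fun _ => memLp_const _, fun _ => memLp_const _⟩
  | succ k ih =>
    obtain ⟨hx, he, hw⟩ := ih
    have hle := history_le H.draws.measurable
    obtain ⟨hxm, hem, hwm⟩ := H.measurable_ecRun γ x0 w0 k
    obtain ⟨hxm', hem', hwm'⟩ := H.measurable_ecRun γ x0 w0 (k + 1)
    have hg := H.memLp_stochGrad hx hw (hxm.mono (hle k) le_rfl)
      (fun i => (hwm i).mono (hle k) le_rfl)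
    have hYm := fun i l => H.measurable_add_smul_stochGrad_ecRun γ x0 w0 k i γ l
    have hY := fun i l => (he i).add ((hg i l).const_smul γ)
    have he' : ∀ i, MemLp (fun ω => (ecRun f xs γ C x0 w0 ζ (k + 1) ω).e i) 2 P := fun i =>
      (H.draws.memLp_compress H.δ_le H.compressor k i (hYm i) (hY i)
        ((hem' i).mono (hle (k + 1)) le_rfl)).1
    refine ⟨?_, he', fun i => ?_⟩
    · have hZ : ∀ i, MemLp (fun ω => (ecRun f xs γ C x0 w0 ζ k ω).e i +
          γ • stochGrad f xs (ecRun f xs γ C x0 w0 ζ k ω) i (ζ k ω i).1) 2 P := fun i =>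
        memLp_comp_finite (measurable_fst.comp (H.draws.measurable_apply k i))
          (h := fun l ω => (ecRun f xs γ C x0 w0 ζ k ω).e i +
            γ • stochGrad f xs (ecRun f xs γ C x0 w0 ζ k ω) i l)
          (fun l => (hYm i l).mono (hle k) le_rfl) (hY i)
      have h1 := hx.sub ((memLp_finsetSum Finset.univ
        fun i _ => (hZ i).sub (he' i)).const_smul ((n : ℝ)⁻¹))
      refine (memLp_congr_ae (Filter.Eventually.of_forall fun ω => ?_)).1 h1
      simp [ecRun, ECState.step]
    · refine (hx.norm.add (hw i).norm).mono' ((hwm' i).mono (hle (k + 1)) le_rfl).aestronglyMeasurable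
        (Filter.Eventually.of_forall fun ω => ?_)
      simp only [ecRun, ECState.step, Pi.add_apply]
      split_ifs <;> simp

end IsECInstance

end Trajectory

/-! ### The parametric assumption -/

section Parametric

variable {d n m : ℕ} {Ω S : Type*} {mΩ : MeasurableSpace Ω} [MeasurableSpace S]
  {f : Fin n → Fin m → Vec d → ℝ} {xs : Vec d} {L μ : ℝ} {ν : Measure S} {δ : ℝ}
  {C : S → Vec d → Vec d} {P : Measure Ω} {p : ℝ} {ζ : ℕ → Ω → Fin n → Fin m × Bool × S}

namespace IsECInstance

theorem gap_nonneg (H : IsECInstance f xs L μ ν δ C P p ζ) (x : Vec d) :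
    0 ≤ globalObj f x - globalObj f xs := sub_nonneg.2 (H.qsc.1 x)

theorem gap_le (H : IsECInstance f xs L μ ν δ C P p ζ) (x : Vec d) :
    globalObj f x - globalObj f xs ≤ L / 2 * ‖x - xs‖ ^ 2 := by
  have := (isLSmooth_globalObj H.n_pos H.m_pos H.smooth).le_add_inner_gradient x xs
  rw [gradient_eq_zero_of_forall_le xs H.qsc.1, inner_zero_left] at this
  linarith

theorem integrable_gap (H : IsECInstance f xs L μ ν δ C P p ζ) [IsProbabilityMeasure P]
    {X : Ω → Vec d} (hX : MemLp X 2 P) :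
    Integrable (fun ω => globalObj f (X ω) - globalObj f xs) P := by
  have hcont : Continuous (globalObj f) :=
    (isLSmooth_globalObj H.n_pos H.m_pos H.smooth).1.continuous
  have hI := ((hX.sub (memLp_const xs)).integrable_norm_pow two_ne_zero).const_mul (L / 2)
  refine hI.mono' ((hcont.comp_aestronglyMeasurable hX.1).sub aestronglyMeasurable_const)
    (Filter.Eventually.of_forall fun ω => ?_)
  rw [Real.norm_of_nonneg (H.gap_nonneg _)]
  exact H.gap_le _

theorem measurable_mean_ecRun (H : IsECInstance f xs L μ ν δ C P p ζ) (γ : ℝ) (x0 : Vec d)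
    (w0 : Fin n → Vec d) (k : ℕ) (i : Fin n) : Measurable[history ζ k] fun ω =>
      gradient (localObj f i) (ecRun f xs γ C x0 w0 ζ k ω).x - gradient (localObj f i) xs := by
  have h1 := (isLSmooth_localObj H.m_pos H.smooth i).continuous_gradient.measurable
  exact (h1.sub measurable_const).comp (H.measurable_ecRun γ x0 w0 k).1

variable [IsProbabilityMeasure P]

theorem memLp_gradient_sub (H : IsECInstance f xs L μ ν δ C P p ζ) {X : Ω → Vec d}
    (hX : MemLp X 2 P) (i : Fin n) (j : Fin m) :
    MemLp (fun ω => gradient (f i j) (X ω) - gradient (f i j) xs) 2 P := by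
  refine ((hX.sub (memLp_const xs)).norm.const_mul L).mono'
    (((H.smooth i j).continuous_gradient.comp_aestronglyMeasurable hX.1).sub
      aestronglyMeasurable_const) (Filter.Eventually.of_forall fun ω => (H.smooth i j).2 _ _)

theorem integrable_average_gradient_sub (H : IsECInstance f xs L μ ν δ C P p ζ) {X : Ω → Vec d}
    (hX : MemLp X 2 P) (i : Fin n) :
    Integrable (fun ω => (m : ℝ)⁻¹ * ∑ j, ‖gradient (f i j) (X ω) - gradient (f i j) xs‖ ^ 2) P :=
  (integrable_finsetSum _ fun j _ =>
    (H.memLp_gradient_sub hX i j).integrable_norm_pow two_ne_zero).const_mul _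

variable [IsProbabilityMeasure ν]

theorem integrable_sigmaSq (H : IsECInstance f xs L μ ν δ C P p ζ) (γ : ℝ) (x0 : Vec d)
    (w0 : Fin n → Vec d) (k : ℕ) :
    Integrable (fun ω => sigmaSq f xs (ecRun f xs γ C x0 w0 ζ k ω).w) P := by
  simp_rw [sigmaSq_eq]
  exact (integrable_finsetSum _ fun i _ => H.integrable_average_gradient_sub
    ((H.memLp_ecRun γ x0 w0 k).2.2 i) i).const_mul _

theorem memLp_stochGrad_ecRun (H : IsECInstance f xs L μ ν δ C P p ζ) (γ : ℝ) (x0 : Vec d)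
    (w0 : Fin n → Vec d) (k : ℕ) (i : Fin n) (l : Fin m) :
    MemLp (fun ω => stochGrad f xs (ecRun f xs γ C x0 w0 ζ k ω) i l) 2 P := by
  have hle := history_le H.draws.measurable k
  obtain ⟨hx, he, hw⟩ := H.memLp_ecRun γ x0 w0 k
  obtain ⟨hxm, hem, hwm⟩ := H.measurable_ecRun γ x0 w0 k
  exact H.memLp_stochGrad hx hw (hxm.mono hle le_rfl) (fun i => (hwm i).mono hle le_rfl) i l

theorem memLp_stochGrad_draw (H : IsECInstance f xs L μ ν δ C P p ζ) (γ : ℝ) (x0 : Vec d)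
    (w0 : Fin n → Vec d) (k : ℕ) (i : Fin n) :
    MemLp (fun ω => stochGrad f xs (ecRun f xs γ C x0 w0 ζ k ω) i (ζ k ω i).1) 2 P :=
  memLp_comp_finite (measurable_fst.comp (H.draws.measurable_apply k i))
    (h := fun l ω => stochGrad f xs (ecRun f xs γ C x0 w0 ζ k ω) i l)
    (fun l => (H.measurable_stochGrad_ecRun γ x0 w0 k i l).mono
      (history_le H.draws.measurable k) le_rfl) (H.memLp_stochGrad_ecRun γ x0 w0 k i)

theorem condExp_stochGrad (H : IsECInstance f xs L μ ν δ C P p ζ) (γ : ℝ) (x0 : Vec d)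
    (w0 : Fin n → Vec d) (k : ℕ) (i : Fin n) :
    P[fun ω => stochGrad f xs (ecRun f xs γ C x0 w0 ζ k ω) i (ζ k ω i).1 | history ζ k] =ᵐ[P]
      fun ω => gradient (localObj f i) (ecRun f xs γ C x0 w0 ζ k ω).x
        - gradient (localObj f i) xs := by
  have h := H.draws.condExp_index H.p_pos.le H.p_lt.le k i
    (h := fun l ω => stochGrad f xs (ecRun f xs γ C x0 w0 ζ k ω) i l)
    (fun l => (H.measurable_stochGrad_ecRun γ x0 w0 k i l).stronglyMeasurable)
    (fun l => (H.memLp_stochGrad_ecRun γ x0 w0 k i l).integrable one_le_two)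
  simpa only [average_stochGrad H.m_pos H.smooth] using h

theorem condExp_average_stochGrad (H : IsECInstance f xs L μ ν δ C P p ζ) (γ : ℝ) (x0 : Vec d)
    (w0 : Fin n → Vec d) (k : ℕ) :
    P[fun ω => (n : ℝ)⁻¹ • ∑ i, stochGrad f xs (ecRun f xs γ C x0 w0 ζ k ω) i (ζ k ω i).1
      | history ζ k] =ᵐ[P] fun ω => gradient (globalObj f) (ecRun f xs γ C x0 w0 ζ k ω).x := by
  have h := condExp_smul_sum (n : ℝ)⁻¹
    (fun i => (H.memLp_stochGrad_draw γ x0 w0 k i).integrable one_le_two)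
    (H.condExp_stochGrad γ x0 w0 k)
  refine h.trans (Filter.Eventually.of_forall fun ω => ?_)
  simp only [Finset.sum_sub_distrib, smul_sub, ← gradient_globalObj H.m_pos H.smooth]
  rw [gradient_eq_zero_of_forall_le xs H.qsc.1, sub_zero]

theorem condExp_norm_stochGrad_sq (H : IsECInstance f xs L μ ν δ C P p ζ) (γ : ℝ) (x0 : Vec d)
    (w0 : Fin n → Vec d) (k : ℕ) (i : Fin n) :
    P[fun ω => ‖stochGrad f xs (ecRun f xs γ C x0 w0 ζ k ω) i (ζ k ω i).1‖ ^ 2 | history ζ k]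
      =ᵐ[P] fun ω => (m : ℝ)⁻¹ * ∑ l, ‖stochGrad f xs (ecRun f xs γ C x0 w0 ζ k ω) i l‖ ^ 2 :=
  H.draws.condExp_index H.p_pos.le H.p_lt.le k i
    (h := fun l ω => ‖stochGrad f xs (ecRun f xs γ C x0 w0 ζ k ω) i l‖ ^ 2)
    (fun l => (H.measurable_stochGrad_ecRun γ x0 w0 k i l).stronglyMeasurable.norm.pow 2)
    (fun l => (H.memLp_stochGrad_ecRun γ x0 w0 k i l).integrable_norm_pow two_ne_zero)

theorem memLp_mean_ecRun (H : IsECInstance f xs L μ ν δ C P p ζ) (γ : ℝ) (x0 : Vec d)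
    (w0 : Fin n → Vec d) (k : ℕ) (i : Fin n) : MemLp (fun ω =>
      gradient (localObj f i) (ecRun f xs γ C x0 w0 ζ k ω).x - gradient (localObj f i) xs) 2 P := by
  refine ((((H.memLp_ecRun γ x0 w0 k).1.sub (memLp_const xs)).norm.const_mul L)).mono'
    ((H.measurable_mean_ecRun γ x0 w0 k i).mono
      (history_le H.draws.measurable k) le_rfl).aestronglyMeasurable
    (Filter.Eventually.of_forall fun ω => (isLSmooth_localObj H.m_pos H.smooth i).2 _ _)

theorem condExp_variance_stochGrad (H : IsECInstance f xs L μ ν δ C P p ζ) (γ : ℝ) (x0 : Vec d)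
    (w0 : Fin n → Vec d) (k : ℕ) (i : Fin n) :
    P[fun ω => ‖stochGrad f xs (ecRun f xs γ C x0 w0 ζ k ω) i (ζ k ω i).1 -
        (P[fun ω' => stochGrad f xs (ecRun f xs γ C x0 w0 ζ k ω') i (ζ k ω' i).1
          | history ζ k]) ω‖ ^ 2 | history ζ k]
      =ᵐ[P] fun ω => (m : ℝ)⁻¹ * ∑ l, ‖stochGrad f xs (ecRun f xs γ C x0 w0 ζ k ω) i l -
        (gradient (localObj f i) (ecRun f xs γ C x0 w0 ζ k ω).x
          - gradient (localObj f i) xs)‖ ^ 2 := by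
  have hm := H.measurable_mean_ecRun γ x0 w0 k i
  refine (condExp_congr_ae ?_).trans (H.draws.condExp_index H.p_pos.le H.p_lt.le k i
    (h := fun l ω => ‖stochGrad f xs (ecRun f xs γ C x0 w0 ζ k ω) i l -
      (gradient (localObj f i) (ecRun f xs γ C x0 w0 ζ k ω).x - gradient (localObj f i) xs)‖ ^ 2)
    (fun l => ((H.measurable_stochGrad_ecRun γ x0 w0 k i l).stronglyMeasurable.sub
      hm.stronglyMeasurable).norm.pow 2)
    (fun l => ((H.memLp_stochGrad_ecRun γ x0 w0 k i l).sub
      (H.memLp_mean_ecRun γ x0 w0 k i)).integrable_norm_pow two_ne_zero))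
  filter_upwards [H.condExp_stochGrad γ x0 w0 k i] with ω hω
  rw [hω]

theorem memLp_average_stochGrad (H : IsECInstance f xs L μ ν δ C P p ζ) (γ : ℝ) (x0 : Vec d)
    (w0 : Fin n → Vec d) (k : ℕ) : MemLp (fun ω =>
      (n : ℝ)⁻¹ • ∑ i, stochGrad f xs (ecRun f xs γ C x0 w0 ζ k ω) i (ζ k ω i).1) 2 P :=
  (memLp_finsetSum Finset.univ fun i _ => H.memLp_stochGrad_draw γ x0 w0 k i).const_smul (n : ℝ)⁻¹

theorem condExp_norm_average_sq_le (H : IsECInstance f xs L μ ν δ C P p ζ) (γ : ℝ) (x0 : Vec d)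
    (w0 : Fin n → Vec d) (k : ℕ) : ∀ᵐ ω ∂P,
      (P[fun ω' => ‖(n : ℝ)⁻¹ • ∑ i,
        stochGrad f xs (ecRun f xs γ C x0 w0 ζ k ω') i (ζ k ω' i).1‖ ^ 2 | history ζ k]) ω ≤
      4 * L * (globalObj f (ecRun f xs γ C x0 w0 ζ k ω).x - globalObj f xs)
        + 2 * sigmaSq f xs (ecRun f xs γ C x0 w0 ζ k ω).w := by
  have hI := fun i => (H.memLp_stochGrad_draw γ x0 w0 k i).integrable_norm_pow two_ne_zero
  have h1 := condExp_mono (m := history ζ k)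
    ((H.memLp_average_stochGrad γ x0 w0 k).integrable_norm_pow two_ne_zero)
    ((integrable_finsetSum Finset.univ fun i _ => hI i).const_mul ((n : ℝ)⁻¹))
    (Filter.Eventually.of_forall fun ω =>
      norm_average_sq_le (by positivity) (inv_natCast_mul_card_fin H.n_pos)
        fun i => stochGrad f xs (ecRun f xs γ C x0 w0 ζ k ω) i (ζ k ω i).1)
  have h2 := condExp_smul_sum (n : ℝ)⁻¹ hI (H.condExp_norm_stochGrad_sq γ x0 w0 k)
  filter_upwards [h1, h2] with ω h1 h2
  refine h1.trans ((le_of_eq h2).trans ?_)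
  exact average_average_norm_stochGrad_sq_le H.m_pos H.L_pos H.convex H.smooth H.qsc.1 _

theorem condExp_sigmaSq_succ_le (H : IsECInstance f xs L μ ν δ C P p ζ) (γ : ℝ) (x0 : Vec d)
    (w0 : Fin n → Vec d) (k : ℕ) : ∀ᵐ ω ∂P,
      (P[fun ω' => sigmaSq f xs (ecRun f xs γ C x0 w0 ζ (k + 1) ω').w | history ζ k]) ω ≤
      (1 - p) * sigmaSq f xs (ecRun f xs γ C x0 w0 ζ k ω).w
        + 2 * (L * p) * (globalObj f (ecRun f xs γ C x0 w0 ζ k ω).x - globalObj f xs) := by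
  obtain ⟨hx, he, hw⟩ := H.memLp_ecRun γ x0 w0 k
  obtain ⟨hxm, hem, hwm⟩ := H.measurable_ecRun γ x0 w0 k
  let A : Fin n → Vec d → ℝ := fun i v =>
    (m : ℝ)⁻¹ * ∑ j, ‖gradient (f i j) v - gradient (f i j) xs‖ ^ 2
  have hA : ∀ i, Measurable (A i) := fun i => by
    refine (Finset.measurable_fun_sum _ fun j _ => ?_).const_mul _
    exact (((H.smooth i j).continuous_gradient.measurable).sub measurable_const).norm.pow_const 2
  have hAx := fun i => H.integrable_average_gradient_sub hx i
  have hAw := fun i => H.integrable_average_gradient_sub (hw i) i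
  have h1 : ∀ i, P[fun ω => if (ζ k ω i).2.1 = true then A i (ecRun f xs γ C x0 w0 ζ k ω).x
      else A i ((ecRun f xs γ C x0 w0 ζ k ω).w i) | history ζ k] =ᵐ[P] fun ω =>
      p • A i (ecRun f xs γ C x0 w0 ζ k ω).x
        + (1 - p) • A i ((ecRun f xs γ C x0 w0 ζ k ω).w i) := fun i =>
    H.draws.condExp_coin H.m_pos H.p_pos.le H.p_lt.le k i
      (((hA i).comp hxm).stronglyMeasurable) (((hA i).comp (hwm i)).stronglyMeasurable)
      (hAx i) (hAw i)
  have hint : ∀ i, Integrable (fun ω => if (ζ k ω i).2.1 = true then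
      A i (ecRun f xs γ C x0 w0 ζ k ω).x else A i ((ecRun f xs γ C x0 w0 ζ k ω).w i)) P := by
    intro i
    have hm2 : Measurable (fun ω => (ζ k ω i).2.1) :=
      measurable_fst.comp (measurable_snd.comp (H.draws.measurable_apply k i))
    exact integrable_comp_finite hm2 (h := fun b ω => if b = true then
      A i (ecRun f xs γ C x0 w0 ζ k ω).x else A i ((ecRun f xs γ C x0 w0 ζ k ω).w i))
      (by rintro (_ | _) <;> simp <;> first | exact hAx i | exact hAw i)
  have h2 := condExp_smul_sum (n : ℝ)⁻¹ hint h1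
  have h3 : (fun ω' => sigmaSq f xs (ecRun f xs γ C x0 w0 ζ (k + 1) ω').w) = fun ω =>
      (n : ℝ)⁻¹ • ∑ i, if (ζ k ω i).2.1 = true then A i (ecRun f xs γ C x0 w0 ζ k ω).x
        else A i ((ecRun f xs γ C x0 w0 ζ k ω).w i) := by
    ext ω
    rw [sigmaSq_eq, smul_eq_mul]
    congr 1
    refine Finset.sum_congr rfl fun i _ => ?_
    simp only [ecRun, ECState.step]
    split_ifs <;> rfl
  rw [h3]
  filter_upwards [h2] with ω h2
  rw [h2]
  have h4 := average_norm_gradient_sub_sq_le H.m_pos H.L_pos H.convex H.smooth H.qsc.1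
    (ecRun f xs γ C x0 w0 ζ k ω).x
  have h5 := mul_le_mul_of_nonneg_left h4 H.p_pos.le
  rw [sigmaSq_eq]
  simp only [smul_eq_mul, Finset.sum_add_distrib, ← Finset.mul_sum, A] at h5 ⊢
  linarith

theorem keyAssumption (H : IsECInstance f xs L μ ν δ C P p ζ) {γ : ℝ} (x0 : Vec d)
    (w0 : Fin n → Vec d) :
    KeyAssumption P (history ζ) (globalObj f) xs (fun k ω => (ecRun f xs γ C x0 w0 ζ k ω).x)
      (fun k i ω => stochGrad f xs (ecRun f xs γ C x0 w0 ζ k ω) i (ζ k ω i).1)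
      (fun _ _ => 0) (fun k ω => sigmaSq f xs (ecRun f xs γ C x0 w0 ζ k ω).w)
      (starConstants L δ p γ) where
  admissible := by
    have h1 := H.L_pos.le
    have h2 := H.p_pos.le
    have h3 := H.δ_pos.le
    have h4 := H.p_lt.le
    have h5 : 0 ≤ constF2 L δ p γ := by unfold constF2; positivity
    simp [KeyConstants.Admissible, starConstants, h1, h2, h4, h5, mul_nonneg]
  memLp_g := H.memLp_stochGrad_draw γ x0 w0
  integrable_gap k := H.integrable_gap (H.memLp_ecRun γ x0 w0 k).1
  integrable_s1 _ := integrable_zero _ _ _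
  integrable_s2 := H.integrable_sigmaSq γ x0 w0
  s1_nonneg _ _ := le_rfl
  s2_nonneg _ _ := sigmaSq_nonneg _
  unbiased := H.condExp_average_stochGrad γ x0 w0
  mean_bound k := by
    have h : ∀ᵐ ω ∂P, ∀ i, (P[fun ω => stochGrad f xs (ecRun f xs γ C x0 w0 ζ k ω) i (ζ k ω i).1
        | history ζ k]) ω = gradient (localObj f i) (ecRun f xs γ C x0 w0 ζ k ω).x
          - gradient (localObj f i) xs := ae_all_iff.2 (H.condExp_stochGrad γ x0 w0 k)
    filter_upwards [h] with ω h
    simp only [h, starConstants]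
    have := average_norm_gradient_localObj_sub_sq_le H.m_pos H.L_pos H.convex H.smooth H.qsc.1
      (ecRun f xs γ C x0 w0 ζ k ω).x
    linarith
  variance_bound k := by
    have h := ae_all_iff.2 (H.condExp_variance_stochGrad γ x0 w0 k)
    filter_upwards [h] with ω h
    simp only [h, starConstants]
    have := average_variance_stochGrad_le H.m_pos H.L_pos H.convex H.smooth H.qsc.1
      (ecRun f xs γ C x0 w0 ζ k ω)
    linarith
  second_moment_bound k := by
    filter_upwards [H.condExp_norm_average_sq_le γ x0 w0 k] with ω h
    simp only [starConstants]
    linarith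
  s1_bound k := by
    have : P[fun _ : Ω => (0 : ℝ) | history ζ k] = 0 := condExp_zero
    rw [this]
    simp [starConstants]
  s2_bound := H.condExp_sigmaSq_succ_le γ x0 w0

end IsECInstance

end Parametric

/-! ### Recursions in expectation -/

theorem integrable_inner_of_memLp_two {Ω E : Type*} [NormedAddCommGroup E] [InnerProductSpace ℝ E]
    {mΩ : MeasurableSpace Ω} {P : Measure Ω} {u v : Ω → E} (hu : MemLp u 2 P) (hv : MemLp v 2 P) :
    Integrable (fun ω => inner ℝ (u ω) (v ω)) P := by
  refine ((hu.integrable_norm_pow two_ne_zero).add (hv.integrable_norm_pow two_ne_zero)).mono'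
    (hu.1.inner hv.1) (Filter.Eventually.of_forall fun ω => ?_)
  refine (norm_inner_le_norm (𝕜 := ℝ) (u ω) (v ω)).trans ?_
  simp only [Pi.add_apply]
  nlinarith [sq_nonneg (‖u ω‖ - ‖v ω‖), sq_nonneg ‖u ω‖, sq_nonneg ‖v ω‖]

theorem ecRun_succ_sub_error {d n m : ℕ} {Ω S : Type*} {f : Fin n → Fin m → Vec d → ℝ}
    {xs : Vec d} {C : S → Vec d → Vec d} {ζ : ℕ → Ω → Fin n → Fin m × Bool × S}
    (γ : ℝ) (x0 : Vec d) (w0 : Fin n → Vec d) (k : ℕ) (ω : Ω) :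
    (ecRun f xs γ C x0 w0 ζ (k + 1) ω).x - (n : ℝ)⁻¹ • ∑ i, (ecRun f xs γ C x0 w0 ζ (k + 1) ω).e i
      = (ecRun f xs γ C x0 w0 ζ k ω).x - (n : ℝ)⁻¹ • ∑ i, (ecRun f xs γ C x0 w0 ζ k ω).e i
        - γ • (n : ℝ)⁻¹ • ∑ i, stochGrad f xs (ecRun f xs γ C x0 w0 ζ k ω) i (ζ k ω i).1 := by
  simp only [ecRun, ECState.step, Finset.sum_sub_distrib, Finset.sum_add_distrib, smul_sub,
    smul_add, ← Finset.smul_sum]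
  rw [smul_comm γ]
  abel

section Recursion

variable {d n m : ℕ} {Ω S : Type*} {mΩ : MeasurableSpace Ω} [MeasurableSpace S]
  {f : Fin n → Fin m → Vec d → ℝ} {xs : Vec d} {L μ : ℝ} {ν : Measure S} {δ : ℝ}
  {C : S → Vec d → Vec d} {P : Measure Ω} {p : ℝ} {ζ : ℕ → Ω → Fin n → Fin m × Bool × S}

namespace IsECInstance

/-- The decrease of `‖x - e - x*‖²` in the direction of the gradient at `x`. -/
theorem neg_two_mul_inner_le (H : IsECInstance f xs L μ ν δ C P p ζ) (x e : Vec d) :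
    -(2 * inner ℝ (x - e - xs) (gradient (globalObj f) x)) ≤
      -(μ / 2) * ‖x - e - xs‖ ^ 2 - (globalObj f x - globalObj f xs) + 3 * L * ‖e‖ ^ 2 := by
  have hL := H.L_pos
  set G := gradient (globalObj f) x with hG
  have h1 := H.qsc.2.2 x
  have h2 : inner ℝ (x - e - xs) G = - inner ℝ G (xs - x) - inner ℝ e G := by
    rw [real_inner_comm G (x - e - xs), real_inner_comm G e, ← inner_neg_right, ← inner_sub_right]
    congr 1; abel
  have h3 : 2 * inner ℝ e G ≤ 2 * L * ‖e‖ ^ 2 + (globalObj f x - globalObj f xs) := by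
    have h4 := norm_gradient_globalObj_sq_le H.n_pos H.m_pos hL H.convex H.smooth H.qsc.1 x
    have h5 := real_inner_le_norm e G
    have h6 : 0 ≤ (2 * L * ‖e‖ - ‖G‖) ^ 2 := sq_nonneg _
    have h7 : 2 * L * (2 * inner ℝ e G) ≤
        2 * L * (2 * L * ‖e‖ ^ 2 + (globalObj f x - globalObj f xs)) := by
      have := mul_le_mul_of_nonneg_left h5 (by positivity : 0 ≤ 4 * L)
      nlinarith
    exact le_of_mul_le_mul_left h7 (by positivity)
  have h8 : ‖x - e - xs‖ ^ 2 ≤ 2 * ‖x - xs‖ ^ 2 + 2 * ‖e‖ ^ 2 := by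
    have := norm_add_sq_le_two (x - xs) (-e)
    rw [norm_neg] at this
    rwa [show x - e - xs = x - xs + -e by abel]
  have h9 : μ * ‖e‖ ^ 2 ≤ L * ‖e‖ ^ 2 := by
    rcases le_or_subsingleton H.n_pos H.m_pos H.smooth H.qsc with h | h
    · gcongr
    · simp [Subsingleton.elim e 0]
  have h10 := mul_le_mul_of_nonneg_left h8 H.μ_nonneg
  rw [h2]
  linarith

/-- One step of the error recursion, averaged over workers and indices. -/
theorem average_norm_error_update_sq_le (H : IsECInstance f xs L μ ν δ C P p ζ) (γ : ℝ)
    (s : ECState d n) :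
    (1 - δ) * ((n : ℝ)⁻¹ * ∑ i, (m : ℝ)⁻¹ * ∑ l, ‖s.e i + γ • stochGrad f xs s i l‖ ^ 2) ≤
      (1 - δ / 2) * ((n : ℝ)⁻¹ * ∑ i, ‖s.e i‖ ^ 2) + (1 - δ) * γ ^ 2 *
        ((4 * L / δ + 4 * L) * (globalObj f s.x - globalObj f xs) + 2 * sigmaSq f xs s.w) := by
  have hδ := H.δ_pos
  have hδ1 : 0 ≤ 1 - δ := sub_nonneg.2 H.δ_le
  set b : Fin n → Vec d := fun i => gradient (localObj f i) s.x - gradient (localObj f i) xs with hb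
  set V : Fin n → ℝ := fun i => (m : ℝ)⁻¹ * ∑ l, ‖stochGrad f xs s i l - b i‖ ^ 2 with hV
  have h1 : ∀ i, (m : ℝ)⁻¹ * ∑ l, ‖s.e i + γ • stochGrad f xs s i l‖ ^ 2 =
      ‖s.e i + γ • b i‖ ^ 2 + γ ^ 2 * V i := by
    intro i
    rw [average_norm_add_sq (inv_natCast_mul_card_fin H.m_pos) (s.e i)
      fun l => γ • stochGrad f xs s i l, ← Finset.smul_sum, smul_comm,
      average_stochGrad H.m_pos H.smooth]
    simp only [← smul_sub, norm_smul, mul_pow, Real.norm_eq_abs, sq_abs, hV, hb, ← Finset.mul_sum]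
    ring
  have h2 : ∀ i, (1 - δ) * ((m : ℝ)⁻¹ * ∑ l, ‖s.e i + γ • stochGrad f xs s i l‖ ^ 2) ≤
      (1 - δ / 2) * ‖s.e i‖ ^ 2 + 2 * (1 - δ) / δ * γ ^ 2 * ‖b i‖ ^ 2
        + (1 - δ) * γ ^ 2 * V i := by
    intro i
    have := mul_norm_add_sq_le hδ H.δ_le (s.e i) (γ • b i)
    rw [norm_smul, mul_pow, Real.norm_eq_abs, sq_abs] at this
    rw [h1 i]
    linarith
  have h3 := average_norm_gradient_localObj_sub_sq_le H.m_pos H.L_pos H.convex H.smooth H.qsc.1 s.x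
  have h4 := average_variance_stochGrad_le H.m_pos H.L_pos H.convex H.smooth H.qsc.1 s
  have h3' := mul_le_mul_of_nonneg_left h3 (by positivity : 0 ≤ 2 * (1 - δ) / δ * γ ^ 2)
  have h4' := mul_le_mul_of_nonneg_left h4 (by positivity : 0 ≤ (1 - δ) * γ ^ 2)
  calc (1 - δ) * ((n : ℝ)⁻¹ * ∑ i, (m : ℝ)⁻¹ * ∑ l, ‖s.e i + γ • stochGrad f xs s i l‖ ^ 2)
      = (n : ℝ)⁻¹ * ∑ i, (1 - δ) * ((m : ℝ)⁻¹ * ∑ l, ‖s.e i + γ • stochGrad f xs s i l‖ ^ 2) := by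
        simp only [← Finset.mul_sum]; ring
    _ ≤ (n : ℝ)⁻¹ * ∑ i, ((1 - δ / 2) * ‖s.e i‖ ^ 2 + 2 * (1 - δ) / δ * γ ^ 2 * ‖b i‖ ^ 2
        + (1 - δ) * γ ^ 2 * V i) := by
        gcongr with i _
        exact h2 i
    _ = (1 - δ / 2) * ((n : ℝ)⁻¹ * ∑ i, ‖s.e i‖ ^ 2)
        + 2 * (1 - δ) / δ * γ ^ 2 * ((n : ℝ)⁻¹ * ∑ i, ‖b i‖ ^ 2)
        + (1 - δ) * γ ^ 2 * ((n : ℝ)⁻¹ * ∑ i, V i) := by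
        rw [Finset.sum_add_distrib, Finset.sum_add_distrib, ← Finset.mul_sum, ← Finset.mul_sum,
          ← Finset.mul_sum]
        ring
    _ ≤ (1 - δ / 2) * ((n : ℝ)⁻¹ * ∑ i, ‖s.e i‖ ^ 2)
        + 2 * (1 - δ) / δ * γ ^ 2 * (2 * L * (globalObj f s.x - globalObj f xs))
        + (1 - δ) * γ ^ 2 * (4 * L * (globalObj f s.x - globalObj f xs)
          + 2 * sigmaSq f xs s.w) := by
        gcongr
    _ = _ := by ring

variable [IsProbabilityMeasure P] [IsProbabilityMeasure ν]

theorem integral_sigmaSq_succ_le (H : IsECInstance f xs L μ ν δ C P p ζ) (γ : ℝ) (x0 : Vec d)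
    (w0 : Fin n → Vec d) (k : ℕ) :
    ∫ ω, sigmaSq f xs (ecRun f xs γ C x0 w0 ζ (k + 1) ω).w ∂P ≤
      (1 - p) * ∫ ω, sigmaSq f xs (ecRun f xs γ C x0 w0 ζ k ω).w ∂P + 2 * (L * p) *
        ∫ ω, (globalObj f (ecRun f xs γ C x0 w0 ζ k ω).x - globalObj f xs) ∂P := by
  have h1 := (H.integrable_sigmaSq γ x0 w0 k).const_mul (1 - p)
  have h2 := (H.integrable_gap (H.memLp_ecRun γ x0 w0 k).1).const_mul (2 * (L * p))
  rw [← integral_condExp (history_le H.draws.measurable k), ← integral_const_mul,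
    ← integral_const_mul, ← integral_add h1 h2]
  exact integral_mono_ae integrable_condExp (h1.add h2) (H.condExp_sigmaSq_succ_le γ x0 w0 k)

theorem integral_norm_average_sq_le (H : IsECInstance f xs L μ ν δ C P p ζ) (γ : ℝ) (x0 : Vec d)
    (w0 : Fin n → Vec d) (k : ℕ) :
    ∫ ω, ‖(n : ℝ)⁻¹ • ∑ i, stochGrad f xs (ecRun f xs γ C x0 w0 ζ k ω) i (ζ k ω i).1‖ ^ 2 ∂P ≤
      4 * L * ∫ ω, (globalObj f (ecRun f xs γ C x0 w0 ζ k ω).x - globalObj f xs) ∂P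
        + 2 * ∫ ω, sigmaSq f xs (ecRun f xs γ C x0 w0 ζ k ω).w ∂P := by
  have h1 := (H.integrable_sigmaSq γ x0 w0 k).const_mul 2
  have h2 := (H.integrable_gap (H.memLp_ecRun γ x0 w0 k).1).const_mul (4 * L)
  rw [← integral_condExp (history_le H.draws.measurable k), ← integral_const_mul,
    ← integral_const_mul, ← integral_add h2 h1]
  exact integral_mono_ae integrable_condExp (h2.add h1) (H.condExp_norm_average_sq_le γ x0 w0 k)

theorem integral_norm_error_succ_le (H : IsECInstance f xs L μ ν δ C P p ζ) (γ : ℝ) (x0 : Vec d)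
    (w0 : Fin n → Vec d) (k : ℕ) :
    ∫ ω, (n : ℝ)⁻¹ * ∑ i, ‖(ecRun f xs γ C x0 w0 ζ (k + 1) ω).e i‖ ^ 2 ∂P ≤
      (1 - δ / 2) * ∫ ω, (n : ℝ)⁻¹ * ∑ i, ‖(ecRun f xs γ C x0 w0 ζ k ω).e i‖ ^ 2 ∂P +
      (1 - δ) * γ ^ 2 * ((4 * L / δ + 4 * L) *
        ∫ ω, (globalObj f (ecRun f xs γ C x0 w0 ζ k ω).x - globalObj f xs) ∂P
        + 2 * ∫ ω, sigmaSq f xs (ecRun f xs γ C x0 w0 ζ k ω).w ∂P) := by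
  have hle := history_le H.draws.measurable
  obtain ⟨hx, he, hw⟩ := H.memLp_ecRun γ x0 w0 k
  have he' := (H.memLp_ecRun γ x0 w0 (k + 1)).2.1
  have hem' := (H.measurable_ecRun γ x0 w0 (k + 1)).2.1
  have hYm := fun i l => H.measurable_add_smul_stochGrad_ecRun γ x0 w0 k i γ l
  have hY := fun i l => (he i).add ((H.memLp_stochGrad_ecRun γ x0 w0 k i l).const_smul γ)
  have hYI := fun i l => (hY i l).integrable_norm_pow two_ne_zero
  have hAI : ∀ i, Integrable (fun ω => (m : ℝ)⁻¹ * ∑ l, ‖(ecRun f xs γ C x0 w0 ζ k ω).e i +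
      γ • stochGrad f xs (ecRun f xs γ C x0 w0 ζ k ω) i l‖ ^ 2) P := fun i =>
    (integrable_finsetSum _ fun l _ => hYI i l).const_mul _
  have h1 : ∀ i, ∫ ω, ‖(ecRun f xs γ C x0 w0 ζ (k + 1) ω).e i‖ ^ 2 ∂P ≤
      (1 - δ) * ∫ ω, (m : ℝ)⁻¹ * ∑ l, ‖(ecRun f xs γ C x0 w0 ζ k ω).e i +
        γ • stochGrad f xs (ecRun f xs γ C x0 w0 ζ k ω) i l‖ ^ 2 ∂P := by
    intro i
    have h2 := (H.draws.memLp_compress H.δ_le H.compressor k i (hYm i) (hY i)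
      ((hem' i).mono (hle (k + 1)) le_rfl)).2
    have h3 := H.draws.integral_index H.p_pos.le H.p_lt.le k i
      (fun l => ((hYm i l).stronglyMeasurable.norm.pow 2)) (hYI i)
    simp only [Pi.pow_apply, smul_eq_mul] at h3
    rw [← h3]
    exact h2
  have hEI := fun i => (he i).integrable_norm_pow two_ne_zero
  have hEI' := fun i => (he' i).integrable_norm_pow two_ne_zero
  have hE : Integrable (fun ω => (n : ℝ)⁻¹ * ∑ i, ‖(ecRun f xs γ C x0 w0 ζ k ω).e i‖ ^ 2) P :=
    (integrable_finsetSum _ fun i _ => hEI i).const_mul _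
  have hS := H.integrable_sigmaSq γ x0 w0 k
  have hG := H.integrable_gap hx
  calc ∫ ω, (n : ℝ)⁻¹ * ∑ i, ‖(ecRun f xs γ C x0 w0 ζ (k + 1) ω).e i‖ ^ 2 ∂P
      = (n : ℝ)⁻¹ * ∑ i, ∫ ω, ‖(ecRun f xs γ C x0 w0 ζ (k + 1) ω).e i‖ ^ 2 ∂P := by
        rw [integral_const_mul, integral_finsetSum _ fun i _ => hEI' i]
    _ ≤ (n : ℝ)⁻¹ * ∑ i, (1 - δ) * ∫ ω, (m : ℝ)⁻¹ * ∑ l, ‖(ecRun f xs γ C x0 w0 ζ k ω).e i +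
        γ • stochGrad f xs (ecRun f xs γ C x0 w0 ζ k ω) i l‖ ^ 2 ∂P := by
        gcongr with i _
        exact h1 i
    _ = ∫ ω, (1 - δ) * ((n : ℝ)⁻¹ * ∑ i, (m : ℝ)⁻¹ * ∑ l, ‖(ecRun f xs γ C x0 w0 ζ k ω).e i +
        γ • stochGrad f xs (ecRun f xs γ C x0 w0 ζ k ω) i l‖ ^ 2) ∂P := by
        rw [integral_const_mul, integral_const_mul, integral_finsetSum _ fun i _ => hAI i,
          ← Finset.mul_sum]
        ring
    _ ≤ ∫ ω, ((1 - δ / 2) * ((n : ℝ)⁻¹ * ∑ i, ‖(ecRun f xs γ C x0 w0 ζ k ω).e i‖ ^ 2) +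
        (1 - δ) * γ ^ 2 * ((4 * L / δ + 4 * L) *
          (globalObj f (ecRun f xs γ C x0 w0 ζ k ω).x - globalObj f xs)
          + 2 * sigmaSq f xs (ecRun f xs γ C x0 w0 ζ k ω).w)) ∂P := by
        refine integral_mono (((integrable_finsetSum _ fun i _ => hAI i).const_mul _).const_mul _)
          ((hE.const_mul _).add (((hG.const_mul _).add (hS.const_mul _)).const_mul _)) fun ω => ?_
        exact H.average_norm_error_update_sq_le γ (ecRun f xs γ C x0 w0 ζ k ω)
    _ = _ := by
        rw [integral_add (hE.const_mul _) (((hG.const_mul _).fun_add (hS.const_mul _)).const_mul _),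
          integral_const_mul, integral_const_mul, integral_const_mul,
          integral_add (hG.const_mul _) (hS.const_mul _), integral_const_mul, integral_const_mul]

theorem memLp_error (H : IsECInstance f xs L μ ν δ C P p ζ) (γ : ℝ) (x0 : Vec d)
    (w0 : Fin n → Vec d) (k : ℕ) :
    MemLp (fun ω => (n : ℝ)⁻¹ • ∑ i, (ecRun f xs γ C x0 w0 ζ k ω).e i) 2 P :=
  (memLp_finsetSum Finset.univ fun i _ => (H.memLp_ecRun γ x0 w0 k).2.1 i).const_smul (n : ℝ)⁻¹

theorem integral_norm_error_le (H : IsECInstance f xs L μ ν δ C P p ζ) (γ : ℝ) (x0 : Vec d)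
    (w0 : Fin n → Vec d) (k : ℕ) :
    ∫ ω, ‖(n : ℝ)⁻¹ • ∑ i, (ecRun f xs γ C x0 w0 ζ k ω).e i‖ ^ 2 ∂P ≤
      ∫ ω, (n : ℝ)⁻¹ * ∑ i, ‖(ecRun f xs γ C x0 w0 ζ k ω).e i‖ ^ 2 ∂P := by
  refine integral_mono ((H.memLp_error γ x0 w0 k).integrable_norm_pow two_ne_zero)
    ((integrable_finsetSum _ fun i _ =>
      ((H.memLp_ecRun γ x0 w0 k).2.1 i).integrable_norm_pow two_ne_zero).const_mul _) fun ω => ?_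
  exact norm_average_sq_le (by positivity) (inv_natCast_mul_card_fin H.n_pos) _

theorem integral_inner_average (H : IsECInstance f xs L μ ν δ C P p ζ) (γ : ℝ) (x0 : Vec d)
    (w0 : Fin n → Vec d) (k : ℕ) {u : Ω → Vec d} (hu : StronglyMeasurable[history ζ k] u)
    (hu2 : MemLp u 2 P) :
    ∫ ω, inner ℝ (u ω) ((n : ℝ)⁻¹ •
        ∑ i, stochGrad f xs (ecRun f xs γ C x0 w0 ζ k ω) i (ζ k ω i).1) ∂P =
      ∫ ω, inner ℝ (u ω) (gradient (globalObj f) (ecRun f xs γ C x0 w0 ζ k ω).x) ∂P := by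
  have hg := H.memLp_average_stochGrad γ x0 w0 k
  have h1 := condExp_bilin_of_stronglyMeasurable_left (μ := P) (innerSL ℝ) hu
    (integrable_inner_of_memLp_two hu2 hg) (hg.integrable one_le_two)
  rw [← integral_condExp (history_le H.draws.measurable k)]
  refine integral_congr_ae ?_
  filter_upwards [h1, H.condExp_average_stochGrad γ x0 w0 k] with ω h1 h2
  refine h1.trans ?_
  rw [h2]
  rfl

/-- One step of the distance of the corrected iterate `x - e` to the minimizer. -/
theorem integral_norm_corrected_succ_le (H : IsECInstance f xs L μ ν δ C P p ζ) {γ : ℝ}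
    (hγ : 0 ≤ γ) (x0 : Vec d) (w0 : Fin n → Vec d) (k : ℕ) :
    ∫ ω, ‖(ecRun f xs γ C x0 w0 ζ (k + 1) ω).x
        - (n : ℝ)⁻¹ • ∑ i, (ecRun f xs γ C x0 w0 ζ (k + 1) ω).e i - xs‖ ^ 2 ∂P ≤
      (1 - γ * μ / 2) * ∫ ω, ‖(ecRun f xs γ C x0 w0 ζ k ω).x
        - (n : ℝ)⁻¹ • ∑ i, (ecRun f xs γ C x0 w0 ζ k ω).e i - xs‖ ^ 2 ∂P
      - γ * ∫ ω, (globalObj f (ecRun f xs γ C x0 w0 ζ k ω).x - globalObj f xs) ∂P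
      + 3 * L * γ * ∫ ω, ‖(n : ℝ)⁻¹ • ∑ i, (ecRun f xs γ C x0 w0 ζ k ω).e i‖ ^ 2 ∂P
      + γ ^ 2 * (4 * L * ∫ ω, (globalObj f (ecRun f xs γ C x0 w0 ζ k ω).x - globalObj f xs) ∂P
        + 2 * ∫ ω, sigmaSq f xs (ecRun f xs γ C x0 w0 ζ k ω).w ∂P) := by
  set x : Ω → Vec d := fun ω => (ecRun f xs γ C x0 w0 ζ k ω).x with hxdef
  set e : Ω → Vec d := fun ω => (n : ℝ)⁻¹ • ∑ i, (ecRun f xs γ C x0 w0 ζ k ω).e i with hedef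
  set g : Ω → Vec d := fun ω =>
    (n : ℝ)⁻¹ • ∑ i, stochGrad f xs (ecRun f xs γ C x0 w0 ζ k ω) i (ζ k ω i).1 with hgdef
  have hx : MemLp x 2 P := (H.memLp_ecRun γ x0 w0 k).1
  have he : MemLp e 2 P := H.memLp_error γ x0 w0 k
  have hg : MemLp g 2 P := H.memLp_average_stochGrad γ x0 w0 k
  have hu : MemLp (fun ω => x ω - e ω - xs) 2 P := (hx.sub he).sub (memLp_const xs)
  have hum : StronglyMeasurable[history ζ k] (fun ω => x ω - e ω - xs) := by
    obtain ⟨hxm, hem, _⟩ := H.measurable_ecRun γ x0 w0 k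
    have hem' : StronglyMeasurable[history ζ k] e :=
      (Finset.stronglyMeasurable_fun_sum Finset.univ
        fun i _ => (hem i).stronglyMeasurable).const_smul (n : ℝ)⁻¹
    exact (hxm.stronglyMeasurable.sub hem').sub stronglyMeasurable_const
  have hinner := H.integral_inner_average γ x0 w0 k hum hu
  have hgrad : MemLp (fun ω => gradient (globalObj f) (x ω)) 2 P := by
    have hs := isLSmooth_globalObj H.n_pos H.m_pos H.smooth
    refine ((hx.sub (memLp_const xs)).norm.const_mul L).mono'
      (hs.continuous_gradient.comp_aestronglyMeasurable hx.1)
      (Filter.Eventually.of_forall fun ω => ?_)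
    have := hs.2 (x ω) xs
    rwa [gradient_eq_zero_of_forall_le xs H.qsc.1, sub_zero] at this
  have hI1 := hu.integrable_norm_pow two_ne_zero
  have hI2 : Integrable (fun ω => inner ℝ (x ω - e ω - xs) (g ω)) P := integrable_inner_of_memLp_two hu hg
  have hI3 := hg.integrable_norm_pow two_ne_zero
  have hI4 : Integrable (fun ω => inner ℝ (x ω - e ω - xs) (gradient (globalObj f) (x ω))) P :=
    integrable_inner_of_memLp_two hu hgrad
  have hI5 := he.integrable_norm_pow two_ne_zero
  have hI6 := H.integrable_gap hx
  have h1 : ∫ ω, ‖(ecRun f xs γ C x0 w0 ζ (k + 1) ω).x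
        - (n : ℝ)⁻¹ • ∑ i, (ecRun f xs γ C x0 w0 ζ (k + 1) ω).e i - xs‖ ^ 2 ∂P =
      ∫ ω, ‖x ω - e ω - xs‖ ^ 2 ∂P - 2 * γ * ∫ ω, inner ℝ (x ω - e ω - xs) (g ω) ∂P
        + γ ^ 2 * ∫ ω, ‖g ω‖ ^ 2 ∂P := by
    rw [← integral_const_mul, ← integral_const_mul, ← integral_sub hI1 (hI2.const_mul _),
      ← integral_add (hI1.sub' (hI2.const_mul _)) (hI3.const_mul _)]
    refine integral_congr_ae (Filter.Eventually.of_forall fun ω => ?_)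
    simp only [ecRun_succ_sub_error]
    rw [sub_right_comm, norm_sub_sq_real, inner_smul_right, norm_smul, mul_pow, Real.norm_eq_abs,
      sq_abs]
    ring
  have h2 : -(2 * ∫ ω, inner ℝ (x ω - e ω - xs) (gradient (globalObj f) (x ω)) ∂P) ≤
      -(μ / 2) * ∫ ω, ‖x ω - e ω - xs‖ ^ 2 ∂P
        - ∫ ω, (globalObj f (x ω) - globalObj f xs) ∂P + 3 * L * ∫ ω, ‖e ω‖ ^ 2 ∂P := by
    rw [← integral_const_mul, ← integral_const_mul, ← integral_const_mul, ← integral_neg,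
      ← integral_sub (hI1.const_mul _) hI6,
      ← integral_add ((hI1.const_mul _).sub' hI6) (hI5.const_mul _)]
    exact integral_mono (hI4.const_mul _).neg (((hI1.const_mul _).sub hI6).add (hI5.const_mul _))
      fun ω => H.neg_two_mul_inner_le (x ω) (e ω)
  have h3 := mul_le_mul_of_nonneg_left (H.integral_norm_average_sq_le γ x0 w0 k) (sq_nonneg γ)
  have h4 := mul_le_mul_of_nonneg_left h2 hγ
  rw [h1, hinner]
  linarith

end IsECInstance

end Recursion

/-! ### Weighted sums of recursive sequences -/

section Weights

variable {η : ℝ}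

theorem weight_pos (hη : η < 1) (k : ℕ) : 0 < weight η k :=
  inv_pos.2 (pow_pos (sub_pos.2 hη) _)

theorem weight_zero_mul (hη : η < 1) : weight η 0 * (1 - η) = 1 := by
  have := (sub_pos.2 hη).ne'
  simp [weight, this]

theorem weight_succ_mul (hη : η < 1) (k : ℕ) : weight η (k + 1) * (1 - η) = weight η k := by
  have := (sub_pos.2 hη).ne'
  rw [weight, weight, pow_succ (1 - η) (k + 1), mul_inv, mul_assoc, inv_mul_cancel₀ this, mul_one]

theorem weightSum_pos (hη : η < 1) (K : ℕ) : 0 < weightSum η K :=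
  Finset.sum_pos (fun k _ => weight_pos hη k) (Finset.nonempty_range_add_one)

/-- Summing the recursion `u (k + 1) ≤ q * u k + b k` against the weights. -/
theorem sum_weight_mul_add_le (hη : η < 1) {u b : ℕ → ℝ} {q : ℝ}
    (hu : ∀ k, u (k + 1) ≤ q * u k + b k) (K : ℕ) :
    (1 - η - q) * ∑ k ∈ Finset.range (K + 1), weight η k * u k + weight η K * u (K + 1) ≤
      u 0 + ∑ k ∈ Finset.range (K + 1), weight η k * b k := by
  induction K with
  | zero =>
    have h1 := mul_le_mul_of_nonneg_left (hu 0) (weight_pos hη 0).le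
    have h2 := congrArg (· * u 0) (weight_zero_mul hη)
    simp only [zero_add, Finset.sum_range_one] at h1 h2 ⊢
    linarith
  | succ K ih =>
    rw [Finset.sum_range_succ, Finset.sum_range_succ (fun k => weight η k * b k) (K + 1)]
    have h1 := mul_le_mul_of_nonneg_left (hu (K + 1)) (weight_pos hη (K + 1)).le
    have h2 : weight η (K + 1) * (1 - η) * u (K + 1) = weight η K * u (K + 1) := by
      rw [weight_succ_mul hη K]
    linarith

theorem sum_weight_mul_le (hη : η < 1) {u b : ℕ → ℝ} {q : ℝ} (hu0 : ∀ k, 0 ≤ u k)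
    (hu : ∀ k, u (k + 1) ≤ q * u k + b k) (K : ℕ) :
    (1 - η - q) * ∑ k ∈ Finset.range (K + 1), weight η k * u k ≤
      u 0 + ∑ k ∈ Finset.range (K + 1), weight η k * b k := by
  have h1 := sum_weight_mul_add_le hη hu K
  have h2 := mul_nonneg (weight_pos hη K).le (hu0 (K + 1))
  linarith

end Weights

section Stepsize

variable {L δ p γ : ℝ}

theorem stepsize_mul_le (hL : 0 < L) (hγ : γ ≤ stepBound L δ p) : γ * L ≤ 3 / 56 := by
  have h := hγ.trans (min_le_left _ _)
  rw [le_div_iff₀ (by positivity)] at h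
  linarith

theorem stepsize_sq_le (hL : 0 < L) (hδ : 0 < δ) (hp1 : p < 1) (hγ0 : 0 ≤ γ)
    (hγ : γ ≤ stepBound L δ p) :
    192 * (L * γ) ^ 2 * (1 + δ * (1 + 2 / (1 - p))) ≤ δ ^ 2 := by
  have h := hγ.trans (min_le_right _ _)
  have h1p : 0 < 1 - p := sub_pos.2 hp1
  have hQ : 0 < 3 * (1 + δ * (1 + 2 / (1 - p))) := by positivity
  rw [le_div_iff₀ (by positivity)] at h
  have h2 := pow_le_pow_left₀ (by positivity) h 2
  rw [mul_pow, mul_pow, Real.sq_sqrt hQ.le] at h2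
  linarith

theorem stepsize_sq_le' (hL : 0 < L) (hδ : 0 < δ) (hp0 : 0 < p) (hp1 : p < 1) (hγ0 : 0 ≤ γ)
    (hγ : γ ≤ stepBound L δ p) : 192 * (L * γ) ^ 2 * (1 + 3 * δ) ≤ δ ^ 2 := by
  refine le_trans ?_ (stepsize_sq_le hL hδ hp1 hγ0 hγ)
  have : 2 ≤ 2 / (1 - p) := by
    rw [le_div_iff₀ (sub_pos.2 hp1)]; linarith
  refine mul_le_mul_of_nonneg_left ?_ (by positivity)
  linarith [mul_le_mul_of_nonneg_left this hδ.le]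

theorem stepsize_mul_le' (hL : 0 < L) (hδ : 0 < δ) (hp0 : 0 < p) (hp1 : p < 1) (hγ0 : 0 ≤ γ)
    (hγ : γ ≤ stepBound L δ p) : L * γ ≤ δ / 8 := by
  have h := stepsize_sq_le' hL hδ hp0 hp1 hγ0 hγ
  refine le_of_sq_le_sq ?_ (by positivity)
  nlinarith [mul_nonneg (sq_nonneg (L * γ)) hδ.le, sq_nonneg (L * γ)]

/-- The weighted sum of the errors, from the recursions of the errors `a` and of `σ`. -/
theorem weighted_error_le {η : ℝ} {r σ a : ℕ → ℝ} (hL : 0 < L) (hδ0 : 0 < δ)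
    (hp0 : 0 < p) (hp1 : p < 1) (hγ0 : 0 ≤ γ) (hγ : γ ≤ stepBound L δ p)
    (hηp : η ≤ p / 4) (hηδ : η ≤ δ / 4)
    (hr : ∀ k, 0 ≤ r k) (hσ : ∀ k, 0 ≤ σ k) (ha : ∀ k, 0 ≤ a k) (ha0 : a 0 = 0)
    (hσs : ∀ k, σ (k + 1) ≤ (1 - p) * σ k + 2 * (L * p) * r k)
    (has : ∀ k, a (k + 1) ≤ (1 - δ / 2) * a k +
      (1 - δ) * γ ^ 2 * ((4 * L / δ + 4 * L) * r k + 2 * σ k)) (K : ℕ) :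
    3 * L * ∑ k ∈ Finset.range (K + 1), weight η k * a k ≤
      1 / 4 * ∑ k ∈ Finset.range (K + 1), weight η k * r k + constF2 L δ p γ * σ 0 := by
  have hη : η < 1 := by linarith
  have h1 := sum_weight_mul_le hη hσ hσs K
  have h2 := sum_weight_mul_le hη ha has K
  have hw := fun k => (weight_pos hη k).le
  set G := ∑ k ∈ Finset.range (K + 1), weight η k * r k with hG
  set V := ∑ k ∈ Finset.range (K + 1), weight η k * σ k with hV
  set A := ∑ k ∈ Finset.range (K + 1), weight η k * a k with hA
  have hG0 : 0 ≤ G := Finset.sum_nonneg fun k _ => mul_nonneg (hw k) (hr k)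
  have hV0 : 0 ≤ V := Finset.sum_nonneg fun k _ => mul_nonneg (hw k) (hσ k)
  have hA0 : 0 ≤ A := Finset.sum_nonneg fun k _ => mul_nonneg (hw k) (ha k)
  have e1 : ∑ k ∈ Finset.range (K + 1), weight η k * (2 * (L * p) * r k) = 2 * (L * p) * G := by
    rw [hG, Finset.mul_sum]
    exact Finset.sum_congr rfl fun k _ => by ring
  have e2 : ∑ k ∈ Finset.range (K + 1),
      weight η k * ((1 - δ) * γ ^ 2 * ((4 * L / δ + 4 * L) * r k + 2 * σ k)) =
      (1 - δ) * γ ^ 2 * ((4 * L / δ + 4 * L) * G + 2 * V) := by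
    rw [hG, hV, Finset.mul_sum, Finset.mul_sum, ← Finset.sum_add_distrib, Finset.mul_sum]
    exact Finset.sum_congr rfl fun k _ => by ring
  rw [e1] at h1
  rw [e2, ha0, zero_add] at h2
  have h3 : V ≤ 4 / (3 * p) * σ 0 + 8 / 3 * L * G := by
    have h4 : 3 * p / 4 * V ≤ σ 0 + 2 * (L * p) * G :=
      le_trans (mul_le_mul_of_nonneg_right (by linarith) hV0) h1
    have h5 : V = 4 / (3 * p) * (3 * p / 4 * V) := by field_simp
    have h6 : 4 / (3 * p) * σ 0 + 8 / 3 * L * G = 4 / (3 * p) * (σ 0 + 2 * (L * p) * G) := by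
      field_simp; ring
    rw [h5, h6]
    gcongr
  have hB0 : 0 ≤ (4 * L / δ + 4 * L) * G + 2 * V := by positivity
  have h7 : δ / 4 * A ≤ γ ^ 2 * ((4 * L / δ + 4 * L) * G + 2 * V) :=
    calc δ / 4 * A ≤ (1 - η - (1 - δ / 2)) * A := mul_le_mul_of_nonneg_right (by linarith) hA0
      _ ≤ (1 - δ) * (γ ^ 2 * ((4 * L / δ + 4 * L) * G + 2 * V)) := by linarith
      _ ≤ 1 * (γ ^ 2 * ((4 * L / δ + 4 * L) * G + 2 * V)) := by gcongr; linarith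
      _ = _ := one_mul _
  have h8 : 3 * L * A ≤ 12 * L / δ * (γ ^ 2 * ((4 * L / δ + 4 * L) * G
      + 2 * (4 / (3 * p) * σ 0 + 8 / 3 * L * G))) :=
    calc 3 * L * A = 12 * L / δ * (δ / 4 * A) := by field_simp; ring
      _ ≤ 12 * L / δ * (γ ^ 2 * ((4 * L / δ + 4 * L) * G + 2 * V)) := by gcongr
      _ ≤ _ := by gcongr
  have h9 : 12 * L / δ * (γ ^ 2 * ((4 * L / δ + 4 * L) * G
      + 2 * (4 / (3 * p) * σ 0 + 8 / 3 * L * G))) =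
      48 * (L * γ) ^ 2 * (1 + 7 / 3 * δ) / δ ^ 2 * G + 32 * L * γ ^ 2 / (δ * p) * σ 0 := by
    field_simp; ring
  have h10 : 48 * (L * γ) ^ 2 * (1 + 7 / 3 * δ) / δ ^ 2 ≤ 1 / 4 := by
    rw [div_le_iff₀ (by positivity)]
    have := stepsize_sq_le' hL hδ0 hp0 hp1 hγ0 hγ
    nlinarith [mul_nonneg (sq_nonneg (L * γ)) hδ0.le]
  have h11 : 32 * L * γ ^ 2 / (δ * p) ≤ constF2 L δ p γ := by
    refine div_le_div_of_nonneg_right ?_ (by positivity)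
    nlinarith [mul_nonneg hL.le (sq_nonneg γ), mul_nonneg (mul_nonneg hL.le (sq_nonneg γ)) hp0.le]
  rw [h9] at h8
  have h12 := mul_le_mul_of_nonneg_right h10 hG0
  have h13 := mul_le_mul_of_nonneg_right h11 (hσ 0)
  linarith

/-- The weighted sum of the gaps `r`, from the recursion of the distances `t` and the bound on the
errors `ε`. -/
theorem weighted_gap_le {η μ : ℝ} {r σ ε t : ℕ → ℝ} (hL : 0 < L)
    (hp0 : 0 < p) (hγ0 : 0 < γ) (hγ : γ ≤ stepBound L δ p)
    (hη1 : η < 1) (hηp : η ≤ p / 4) (hημ : η ≤ γ * μ / 2)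
    (hr : ∀ k, 0 ≤ r k) (hσ : ∀ k, 0 ≤ σ k) (ht : ∀ k, 0 ≤ t k)
    (hσs : ∀ k, σ (k + 1) ≤ (1 - p) * σ k + 2 * (L * p) * r k)
    (hts : ∀ k, t (k + 1) ≤ (1 - γ * μ / 2) * t k - γ * r k + 3 * L * γ * ε k
      + γ ^ 2 * (4 * L * r k + 2 * σ k)) {F : ℝ} (K : ℕ)
    (hε : 3 * L * ∑ k ∈ Finset.range (K + 1), weight η k * ε k ≤
      1 / 4 * ∑ k ∈ Finset.range (K + 1), weight η k * r k + F) :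
    ∑ k ∈ Finset.range (K + 1), weight η k * r k ≤
      4 * (t 0 + 8 / (3 * p) * γ ^ 2 * σ 0 + γ * F) / γ := by
  have hγL := stepsize_mul_le hL hγ
  set M := 8 / (3 * p) * γ ^ 2 with hM
  have hM0 : 0 ≤ M := by positivity
  have hMp : M * p = 8 / 3 * γ ^ 2 := by rw [hM]; field_simp
  have hrec : ∀ k, t (k + 1) + M * σ (k + 1) ≤ (1 - η) * (t k + M * σ k)
      + (3 * L * γ * ε k - γ / 2 * r k) := by
    intro k
    have h1 := mul_le_mul_of_nonneg_left (hσs k) hM0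
    have h2 : M * ((1 - p) * σ k + 2 * (L * p) * r k) =
        M * σ k - 8 / 3 * γ ^ 2 * σ k + 16 / 3 * γ ^ 2 * L * r k := by
      linear_combination (2 * L * r k - σ k) * hMp
    have h3 : η * (M * σ k) ≤ 2 / 3 * γ ^ 2 * σ k := by
      have := mul_le_mul_of_nonneg_right hηp (mul_nonneg hM0 (hσ k))
      have h' : p / 4 * (M * σ k) = 2 / 3 * γ ^ 2 * σ k := by
        linear_combination (1 / 4 * σ k) * hMp
      linarith
    have h4 := mul_le_mul_of_nonneg_right hημ (ht k)
    have h5 := mul_le_mul_of_nonneg_right hγL (mul_nonneg hγ0.le (hr k))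
    have h6 := hts k
    linarith
  have h := sum_weight_mul_le hη1 (fun k => add_nonneg (ht k) (mul_nonneg hM0 (hσ k))) hrec K
  have e : ∑ k ∈ Finset.range (K + 1), weight η k * (3 * L * γ * ε k - γ / 2 * r k) =
      γ * (3 * L * ∑ k ∈ Finset.range (K + 1), weight η k * ε k)
        - γ / 2 * ∑ k ∈ Finset.range (K + 1), weight η k * r k := by
    rw [Finset.mul_sum, Finset.mul_sum, Finset.mul_sum, ← Finset.sum_sub_distrib]
    exact Finset.sum_congr rfl fun k _ => by ring
  rw [e] at h
  have h' := mul_le_mul_of_nonneg_left hε hγ0.le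
  rw [le_div_iff₀ hγ0]
  linarith

theorem inv_stepBound_le (hL : 0 < L) (hδ0 : 0 < δ) (hδ1 : δ ≤ 1) (hp0 : 0 < p) (hp1 : p < 1) :
    (stepBound L δ p)⁻¹ ≤ 47 * (L / (δ * √(1 - p))) := by
  have h1p : 0 < 1 - p := sub_pos.2 hp1
  have hs0 : 0 < √(1 - p) := Real.sqrt_pos.2 h1p
  have hs1 : √(1 - p) ≤ 1 := by
    rw [Real.sqrt_le_iff]; constructor <;> linarith
  have hD : 0 < δ * √(1 - p) := by positivity
  have hD1 : δ * √(1 - p) ≤ 1 := mul_le_one₀ hδ1 hs0.le hs1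
  have hle : (47 * (L / (δ * √(1 - p))))⁻¹ ≤ stepBound L δ p := by
    have hrw : (47 * (L / (δ * √(1 - p))))⁻¹ = δ * √(1 - p) / (47 * L) := by
      field_simp
    rw [hrw]
    refine le_min ?_ ?_
    · rw [div_le_div_iff₀ (by positivity) (by positivity)]
      nlinarith
    · have hQ : √(3 * (1 + δ * (1 + 2 / (1 - p)))) * √(1 - p) ≤ 47 / 8 := by
        rw [← Real.sqrt_mul (by positivity)]
        refine Real.sqrt_le_iff.2 ⟨by norm_num, ?_⟩
        have : 3 * (1 + δ * (1 + 2 / (1 - p))) * (1 - p) = 3 * ((1 - p) + δ * ((1 - p) + 2)) := by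
          field_simp
        rw [this]
        nlinarith [mul_le_mul_of_nonneg_right hδ1 (by linarith : 0 ≤ (1 - p) + 2)]
      have hQ0 : 0 < √(3 * (1 + δ * (1 + 2 / (1 - p)))) := Real.sqrt_pos.2 (by positivity)
      rw [div_le_div_iff₀ (by positivity) (by positivity)]
      have := mul_le_mul_of_nonneg_left hQ (by positivity : 0 ≤ 8 * (δ * L))
      linarith
  exact inv_le_of_inv_le₀ (by positivity) hle

end Stepsize

/-- A linear rate turns into an iteration complexity. -/
theorem pow_mul_le_of_log_le {η Φ ε R : ℝ} (hη0 : 0 < η) (hη1 : η ≤ 1) (hΦ : 0 ≤ Φ) (hε : 0 < ε)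
    (hR : η⁻¹ ≤ R) {K : ℕ} (hK : R * Real.log (Φ / ε) ≤ K) : (1 - η) ^ K * Φ ≤ ε := by
  have h1 : 0 ≤ 1 - η := by linarith
  rcases le_or_gt Φ ε with h | h
  · calc (1 - η) ^ K * Φ ≤ 1 * Φ := by
          gcongr; exact pow_le_one₀ h1 (by linarith)
      _ ≤ ε := by linarith
  · have hΦ0 : 0 < Φ := hε.trans h
    have hlog : 0 ≤ Real.log (Φ / ε) := Real.log_nonneg ((one_le_div hε).2 h.le)
    have h2 : Real.log (Φ / ε) ≤ η * K := by
      have := (mul_le_mul_of_nonneg_right hR hlog).trans hK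
      have := mul_le_mul_of_nonneg_left this hη0.le
      rwa [← mul_assoc, mul_inv_cancel₀ hη0.ne', one_mul] at this
    have h3 : (1 - η) ^ K ≤ Real.exp (-(η * K)) := by
      have : 1 - η ≤ Real.exp (-η) := Real.one_sub_le_exp_neg η
      calc (1 - η) ^ K ≤ Real.exp (-η) ^ K := pow_le_pow_left₀ h1 this K
        _ = Real.exp (-(η * K)) := by rw [← Real.exp_nat_mul]; congr 1; ring
    have h4 : Real.exp (-(η * K)) ≤ ε / Φ := by
      rw [← Real.exp_log (by positivity : 0 < ε / Φ), Real.exp_le_exp,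
        ← inv_div Φ ε, Real.log_inv]
      linarith
    calc (1 - η) ^ K * Φ ≤ ε / Φ * Φ := by gcongr; exact h3.trans h4
      _ = ε := div_mul_cancel₀ _ hΦ0.ne'

/-! ### Convergence -/

section Convergence

variable {d n m : ℕ} {Ω S : Type*} {mΩ : MeasurableSpace Ω} [MeasurableSpace S]
  {f : Fin n → Fin m → Vec d → ℝ} {xs : Vec d} {L μ : ℝ} {ν : Measure S} {δ : ℝ}
  {C : S → Vec d → Vec d} {P : Measure Ω} {p : ℝ} {ζ : ℕ → Ω → Fin n → Fin m × Bool × S}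

theorem ConvexOn.weightedAvg_sub_le {h : Vec d → ℝ} (hc : ConvexOn ℝ Set.univ h) {η : ℝ}
    (hη : η < 1) (x : ℕ → Vec d) (K : ℕ) (c : ℝ) :
    h (weightedAvg η x K) - c ≤
      (weightSum η K)⁻¹ * ∑ k ∈ Finset.range (K + 1), weight η k * (h (x k) - c) := by
  have hW := weightSum_pos hη K
  have h1 : ∑ k ∈ Finset.range (K + 1), (weightSum η K)⁻¹ * weight η k = 1 := by
    rw [← Finset.mul_sum]
    exact inv_mul_cancel₀ hW.ne'
  have h2 := hc.map_sum_le (t := Finset.range (K + 1))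
    (w := fun k => (weightSum η K)⁻¹ * weight η k) (p := x)
    (fun k _ => mul_nonneg (inv_nonneg.2 hW.le) (weight_pos hη k).le) h1 fun k _ => trivial
  have h3 : ∑ k ∈ Finset.range (K + 1), ((weightSum η K)⁻¹ * weight η k) • x k =
      weightedAvg η x K := by
    simp only [weightedAvg, Finset.smul_sum, smul_smul]
  have h4 : (weightSum η K)⁻¹ * ∑ k ∈ Finset.range (K + 1), weight η k * (h (x k) - c) =
      ∑ k ∈ Finset.range (K + 1), ((weightSum η K)⁻¹ * weight η k) • h (x k) - c := by
    simp only [mul_sub, Finset.sum_sub_distrib, ← Finset.sum_mul, smul_eq_mul, mul_assoc,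
      ← Finset.mul_sum]
    congr 1
    rw [← mul_assoc]
    exact (congrArg (· * c) (inv_mul_cancel₀ hW.ne')).trans (one_mul c)
  rw [h3] at h2
  rw [h4]
  linarith

namespace IsECInstance

variable [IsProbabilityMeasure P] [IsProbabilityMeasure ν]

theorem memLp_weightedAvg (H : IsECInstance f xs L μ ν δ C P p ζ) (γ : ℝ) (x0 : Vec d)
    (w0 : Fin n → Vec d) (η : ℝ) (K : ℕ) :
    MemLp (fun ω => weightedAvg η (fun k => (ecRun f xs γ C x0 w0 ζ k ω).x) K) 2 P :=
  (memLp_finsetSum (Finset.range (K + 1)) fun k _ =>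
    (H.memLp_ecRun γ x0 w0 k).1.const_smul (weight η k)).const_smul (weightSum η K)⁻¹

theorem weighted_error_sum_le (H : IsECInstance f xs L μ ν δ C P p ζ) {γ η : ℝ} (hγ0 : 0 < γ)
    (hγ : γ ≤ stepBound L δ p) (hηp : η ≤ p / 4) (hημ : η ≤ γ * μ / 2) (x0 : Vec d)
    (w0 : Fin n → Vec d) (K : ℕ) :
    3 * L * ∑ k ∈ Finset.range (K + 1), weight η k *
        ∫ ω, ‖(n : ℝ)⁻¹ • ∑ i, (ecRun f xs γ C x0 w0 ζ k ω).e i‖ ^ 2 ∂P ≤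
      1 / 4 * ∑ k ∈ Finset.range (K + 1), weight η k *
        ∫ ω, (globalObj f (ecRun f xs γ C x0 w0 ζ k ω).x - globalObj f xs) ∂P
      + constF2 L δ p γ * sigmaSq f xs w0 := by
  have hL := H.L_pos
  have hδ := H.δ_pos
  have hp := H.p_pos
  have hη : η < 1 := by linarith [H.p_lt]
  have hw := fun k => (weight_pos hη k).le
  have hr : ∀ k, 0 ≤ ∫ ω, (globalObj f (ecRun f xs γ C x0 w0 ζ k ω).x - globalObj f xs) ∂P :=
    fun k => integral_nonneg fun ω => H.gap_nonneg _
  rcases le_or_subsingleton H.n_pos H.m_pos H.smooth H.qsc with hμ | hsub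
  · have hηδ : η ≤ δ / 4 := by
      have h1 := stepsize_mul_le' hL hδ hp H.p_lt hγ0.le hγ
      have h2 := mul_le_mul_of_nonneg_left hμ hγ0.le
      linarith
    have h := weighted_error_le (r := fun k =>
        ∫ ω, (globalObj f (ecRun f xs γ C x0 w0 ζ k ω).x - globalObj f xs) ∂P)
      (σ := fun k => ∫ ω, sigmaSq f xs (ecRun f xs γ C x0 w0 ζ k ω).w ∂P)
      (a := fun k => ∫ ω, (n : ℝ)⁻¹ * ∑ i, ‖(ecRun f xs γ C x0 w0 ζ k ω).e i‖ ^ 2 ∂P)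
      hL hδ hp H.p_lt hγ0.le hγ hηp hηδ hr (fun k => integral_nonneg fun ω => sigmaSq_nonneg _)
      (fun k => integral_nonneg fun ω => by positivity) (by simp [ecRun])
      (H.integral_sigmaSq_succ_le γ x0 w0) (H.integral_norm_error_succ_le γ x0 w0) K
    have h0 : ∫ ω, sigmaSq f xs (ecRun f xs γ C x0 w0 ζ 0 ω).w ∂P = sigmaSq f xs w0 := by
      simp [ecRun]
    simp only [h0] at h
    refine le_trans ?_ h
    refine mul_le_mul_of_nonneg_left (Finset.sum_le_sum fun k _ => ?_) (by positivity)
    exact mul_le_mul_of_nonneg_left (H.integral_norm_error_le γ x0 w0 k) (hw k)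
  · have h0 : ∀ v : Vec d, ‖v‖ = 0 := fun v => by rw [Subsingleton.elim v 0, norm_zero]
    simp only [h0]
    have h1 : 0 ≤ constF2 L δ p γ * sigmaSq f xs w0 :=
      mul_nonneg (by unfold constF2; positivity) (sigmaSq_nonneg _)
    have h2 : 0 ≤ ∑ k ∈ Finset.range (K + 1), weight η k *
        ∫ ω, (globalObj f (ecRun f xs γ C x0 w0 ζ k ω).x - globalObj f xs) ∂P :=
      Finset.sum_nonneg fun k _ => mul_nonneg (hw k) (hr k)
    simp
    linarith

theorem weighted_gap_sum_le (H : IsECInstance f xs L μ ν δ C P p ζ) {γ η : ℝ} (hγ0 : 0 < γ)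
    (hγ : γ ≤ stepBound L δ p) (hηp : η ≤ p / 4) (hημ : η ≤ γ * μ / 2) (x0 : Vec d)
    (w0 : Fin n → Vec d) (K : ℕ) :
    ∑ k ∈ Finset.range (K + 1), weight η k *
        ∫ ω, (globalObj f (ecRun f xs γ C x0 w0 ζ k ω).x - globalObj f xs) ∂P ≤
      initConst f xs L δ p γ x0 w0 := by
  have hη : η < 1 := by linarith [H.p_lt]
  have h := weighted_gap_le (μ := μ) (r := fun k =>
      ∫ ω, (globalObj f (ecRun f xs γ C x0 w0 ζ k ω).x - globalObj f xs) ∂P)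
    (σ := fun k => ∫ ω, sigmaSq f xs (ecRun f xs γ C x0 w0 ζ k ω).w ∂P)
    (ε := fun k => ∫ ω, ‖(n : ℝ)⁻¹ • ∑ i, (ecRun f xs γ C x0 w0 ζ k ω).e i‖ ^ 2 ∂P)
    (t := fun k => ∫ ω, ‖(ecRun f xs γ C x0 w0 ζ k ω).x
        - (n : ℝ)⁻¹ • ∑ i, (ecRun f xs γ C x0 w0 ζ k ω).e i - xs‖ ^ 2 ∂P)
    H.L_pos H.p_pos hγ0 hγ hη hηp hημ (fun k => integral_nonneg fun ω => H.gap_nonneg _)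
    (fun k => integral_nonneg fun ω => sigmaSq_nonneg _)
    (fun k => integral_nonneg fun ω => by positivity)
    (H.integral_sigmaSq_succ_le γ x0 w0) (H.integral_norm_corrected_succ_le hγ0.le x0 w0) K
    (H.weighted_error_sum_le hγ0 hγ hηp hημ x0 w0 K)
  refine h.trans (le_of_eq ?_)
  simp [ecRun, initConst, lyapunov, mul_assoc]

theorem integral_gap_weightedAvg_le (H : IsECInstance f xs L μ ν δ C P p ζ) {γ η : ℝ} (hγ0 : 0 < γ)
    (hγ : γ ≤ stepBound L δ p) (hηp : η ≤ p / 4) (hημ : η ≤ γ * μ / 2) (x0 : Vec d)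
    (w0 : Fin n → Vec d) (K : ℕ) :
    ∫ ω, (globalObj f (weightedAvg η (fun k => (ecRun f xs γ C x0 w0 ζ k ω).x) K)
        - globalObj f xs) ∂P ≤ (weightSum η K)⁻¹ * initConst f xs L δ p γ x0 w0 := by
  have hη : η < 1 := by linarith [H.p_lt]
  have hI := fun k => (H.integrable_gap (H.memLp_ecRun γ x0 w0 k).1).const_mul (weight η k)
  have hI' := (integrable_finsetSum (Finset.range (K + 1)) fun k _ => hI k).const_mul
    (weightSum η K)⁻¹
  refine (integral_mono (H.integrable_gap (H.memLp_weightedAvg γ x0 w0 η K)) hI' fun ω =>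
    (convexOn_globalObj H.convex).weightedAvg_sub_le hη
      (fun k => (ecRun f xs γ C x0 w0 ζ k ω).x) K (globalObj f xs)).trans ?_
  rw [integral_const_mul, integral_finsetSum _ fun k _ => hI k]
  simp only [integral_const_mul]
  exact mul_le_mul_of_nonneg_left (H.weighted_gap_sum_le hγ0 hγ hηp hημ x0 w0 K)
    (inv_nonneg.2 (weightSum_pos hη K).le)

end IsECInstance

theorem initConst_nonneg {γ : ℝ} (hL : 0 ≤ L) (hδ : 0 ≤ δ) (hp : 0 ≤ p) (hγ : 0 ≤ γ) (x0 : Vec d)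
    (w0 : Fin n → Vec d) : 0 ≤ initConst f xs L δ p γ x0 w0 := by
  have := sigmaSq_nonneg (f := f) (xs := xs) w0
  unfold initConst lyapunov constF2
  positivity

theorem inv_weightSum_le {η : ℝ} (hη0 : 0 ≤ η) (hη1 : η < 1) (K : ℕ) :
    (weightSum η K)⁻¹ ≤ (1 - η) ^ K := by
  have h1 : 0 < 1 - η := sub_pos.2 hη1
  have h2 : weight η K ≤ weightSum η K :=
    Finset.single_le_sum (fun k _ => (weight_pos hη1 k).le) (Finset.self_mem_range_succ K)
  calc (weightSum η K)⁻¹ ≤ (weight η K)⁻¹ := inv_anti₀ (weight_pos hη1 K) h2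
    _ = (1 - η) ^ K * (1 - η) := by rw [weight, inv_inv, pow_succ]
    _ ≤ (1 - η) ^ K := mul_le_of_le_one_right (by positivity) (by linarith)

theorem inv_min_rate_le {κ q D : ℝ} (hq : 0 < q) (hp : 0 < p) (hqD : q⁻¹ ≤ D)
    (hκ : κ = min (q / 2) (p / 4)) : κ⁻¹ ≤ 2 * D + 4 / p := by
  have hD : 0 ≤ D := (inv_pos.2 hq).le.trans hqD
  rw [hκ]
  rcases min_choice (q / 2) (p / 4) with h | h <;> rw [h, inv_div]
  · have : 2 / q = 2 * q⁻¹ := rfl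
    have h4 : 0 ≤ 4 / p := by positivity
    linarith
  · linarith

end Convergence

theorem mainTheorem7 :
    ∃ c : ℝ, 0 < c ∧
    ∀ (d n m : ℕ) (_hn : 0 < n) (_hm : 0 < m)
      -- the problem
      (f : Fin n → Fin m → Vec d → ℝ) (xs : Vec d) (L μ : ℝ) (_hL : 0 < L) (_hμ : 0 ≤ μ)
      (_hconv : ∀ i j, ConvexOn ℝ Set.univ (f i j))
      (_hsmooth : ∀ i j, IsLSmooth L (f i j))
      (_hqsc : IsQuasiStronglyConvex μ (globalObj f) xs)
      -- the compressor
      (S : Type*) [MeasurableSpace S] (ν : Measure S) [IsProbabilityMeasure ν]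
      (δ : ℝ) (_hδ0 : 0 < δ) (_hδ1 : δ ≤ 1)
      (C : S → Vec d → Vec d) (_hC : IsCompressor ν δ C)
      -- the random choices of the method
      (Ω : Type*) [MeasurableSpace Ω] (P : Measure Ω) [IsProbabilityMeasure P]
      (p : ℝ) (_hp0 : 0 < p) (_hp1 : p < 1)
      (ζ : ℕ → Ω → Fin n → Fin m × Bool × S) (_hζ : IsDrawSequence P ν p ζ)
      -- stepsize and starting points
      (γ : ℝ) (_hγ0 : 0 < γ) (_hγ : γ ≤ stepBound L δ p)
      (x0 : Vec d) (w0 : Fin n → Vec d),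
      let run : ℕ → Ω → ECState d n := ecRun f xs γ C x0 w0 ζ
      let x : ℕ → Ω → Vec d := fun k ω => (run k ω).x
      let e : ℕ → Ω → Vec d := fun k ω => (n : ℝ)⁻¹ • ∑ i, (run k ω).e i
      let g : ℕ → Fin n → Ω → Vec d := fun k i ω => stochGrad f xs (run k ω) i (ζ k ω i).1
      let s2 : ℕ → Ω → ℝ := fun k ω => sigmaSq f xs (run k ω).w
      let η : ℝ := min (γ * μ / 2) (p / 4)
      let gap : ℕ → Ω → ℝ := fun K ω =>
        globalObj f (weightedAvg η (fun k => x k ω) K) - globalObj f xs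
      let Φ : ℝ := initConst f xs L δ p γ x0 w0
      -- the parametric assumption holds with the stated constants
      KeyAssumption P (history ζ) (globalObj f) xs x g (fun _ _ => 0) s2 (starConstants L δ p γ) ∧
      ErrorSumBound P (globalObj f) xs x e (fun _ _ => 0) s2 L μ γ (starConstants L δ p γ) ∧
      -- convergence
      (∀ K, Integrable (gap K) P) ∧
      (0 < μ → ∀ K : ℕ, ∫ ω, gap K ω ∂P ≤ (1 - min (γ * μ / 2) (p / 4)) ^ K * Φ) ∧
      (μ = 0 → ∀ K : ℕ, 1 ≤ K → ∫ ω, gap K ω ∂P ≤ Φ / K) ∧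
      -- iteration complexity with the largest stepsize
      (0 < μ → γ = stepBound L δ p → ∀ ε : ℝ, 0 < ε → ∀ K : ℕ,
        c * (1 / p + L / μ / (δ * √(1 - p))) * Real.log (Φ / ε) ≤ K → ∫ ω, gap K ω ∂P ≤ ε) ∧
      (0 < μ → γ = stepBound L δ p → 2 ≤ m → p = 1 / m → ∀ ε : ℝ, 0 < ε → ∀ K : ℕ,
        c * (m + L / μ / δ) * Real.log (Φ / ε) ≤ K → ∫ ω, gap K ω ∂P ≤ ε) := by
  refine ⟨200, by norm_num, ?_⟩
  intro d n m hn hm f xs L μ hL hμ hconv hsmooth hqsc S _ ν _ δ hδ0 hδ1 C hC Ω _ P _ p hp0 hp1 ζ hζ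
    γ hγ0 hγ x0 w0 run x e g s2 η gap Φ
  have H : IsECInstance f xs L μ ν δ C P p ζ :=
    ⟨hn, hm, hL, hμ, hconv, hsmooth, hqsc, hδ0, hδ1, hC, hp0, hp1, hζ⟩
  have hηp : η ≤ p / 4 := min_le_right _ _
  have hημ : η ≤ γ * μ / 2 := min_le_left _ _
  have hη0 : 0 ≤ η := le_min (by positivity) (by positivity)
  have hη1 : η < 1 := by linarith
  have hΦ : 0 ≤ Φ := initConst_nonneg hL.le hδ0.le hp0.le hγ0.le x0 w0
  have hgap : ∀ K, ∫ ω, gap K ω ∂P ≤ (weightSum η K)⁻¹ * Φ :=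
    H.integral_gap_weightedAvg_le hγ0 hγ hηp hημ x0 w0
  have hlin : ∀ K, ∫ ω, gap K ω ∂P ≤ (1 - η) ^ K * Φ := fun K =>
    (hgap K).trans (mul_le_mul_of_nonneg_right (inv_weightSum_le hη0 hη1 K) hΦ)
  have hrate : 0 < μ → γ = stepBound L δ p →
      0 < η ∧ η⁻¹ ≤ 94 * (L / μ / (δ * √(1 - p))) + 4 / p := by
    intro hμ0 hγe
    have hinv : (γ * μ)⁻¹ ≤ 47 * (L / μ / (δ * √(1 - p))) := by
      have h1 := inv_stepBound_le hL hδ0 hδ1 hp0 hp1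
      rw [← hγe] at h1
      have h2 := mul_le_mul_of_nonneg_right h1 (inv_nonneg.2 hμ)
      rw [mul_inv]
      refine h2.trans (le_of_eq ?_)
      ring
    refine ⟨lt_min (by positivity) (by positivity), ?_⟩
    have := inv_min_rate_le (mul_pos hγ0 hμ0) hp0 hinv rfl
    linarith
  refine ⟨H.keyAssumption x0 w0, ⟨H.memLp_error γ x0 w0, fun K => ?_⟩,
    fun K => H.integrable_gap (H.memLp_weightedAvg γ x0 w0 η K), fun _ => hlin, ?_, ?_, ?_⟩
  · have hη : min (γ * μ / 2) (min ((starConstants L δ p γ).ρ1 / 4)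
        ((starConstants L δ p γ).ρ2 / 4)) = η := by
      have : p / 4 ≤ 1 / 4 := by linarith
      simp only [starConstants, min_eq_right this, η]
    intro η'
    have hη' : η' = η := hη
    have h := H.weighted_error_sum_le hγ0 hγ hηp hημ x0 w0 K
    rw [hη']
    simpa [starConstants, s2, run, ecRun, x, e] using h
  · intro hμ0 K hK
    have hη : η = 0 := le_antisymm (hημ.trans (by simp [hμ0])) hη0
    have hW : weightSum η K = K + 1 := by simp [weightSum, weight, hη]
    have hK0 : (0 : ℝ) < K := by exact_mod_cast hK
    refine (hgap K).trans ?_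
    rw [hW, inv_mul_eq_div]
    gcongr
    linarith
  · intro hμ0 hγe ε hε K hK
    obtain ⟨hη, hinv⟩ := hrate hμ0 hγe
    refine (hlin K).trans (pow_mul_le_of_log_le hη hη1.le hΦ hε (hinv.trans ?_) hK)
    have h1 : 0 ≤ L / μ / (δ * √(1 - p)) := by positivity
    have h2 : 0 < 1 / p := by positivity
    have h3 : 4 / p = 4 * (1 / p) := by ring
    linarith
  · intro hμ0 hγe hm2 hpm ε hε K hK
    obtain ⟨hη, hinv⟩ := hrate hμ0 hγe
    refine (hlin K).trans (pow_mul_le_of_log_le hη hη1.le hΦ hε (hinv.trans ?_) hK)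
    have hm2' : (2 : ℝ) ≤ m := by exact_mod_cast hm2
    have hp2 : p ≤ 1 / 2 := by
      rw [hpm]
      exact one_div_le_one_div_of_le (by norm_num) hm2'
    have hs : 1 / 2 ≤ √(1 - p) := Real.le_sqrt_of_sq_le (by linarith)
    have h1 : L / μ / (δ * √(1 - p)) ≤ 2 * (L / μ / δ) :=
      calc L / μ / (δ * √(1 - p)) ≤ L / μ / (δ * (1 / 2)) := by gcongr
        _ = 2 * (L / μ / δ) := by field_simp
    have h2 : 4 / p = 4 * m := by rw [hpm]; field_simp
    have h3 : 0 ≤ L / μ / δ := by positivity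
    linarith
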